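/- Let $q$ be a nonzero complex number that is not a root of unity, and write $[n]=\frac{q^n-q^{-n}}{q-q^{-1}}$. The quantum Schrödinger algebra $U_q(\mathfrak s)$ is the unital associative $\mathbb C$-algebra generated by $E,F,K,K^{-1},X,Y,Z$ with $KK^{-1}=K^{-1}K=1$, $Z$ central, and relations $$EF-FE=\tfrac{K-K^{-1}}{q-q^{-1}},\quad KEK^{-1}=q^2E,\quad KFK^{-1}=q^{-2}F,\quad KXK^{-1}=qX,\quad KYK^{-1}=q^{-1}Y,$$ $$qYX-XY=Z,\quad EX=qXE,\quad EY=X+q^{-1}YE,\quad FX=YK^{-1}+XF,\quad FY=YF.$$ The subalgebra generated by $E,F,K,K^{-1}$ is the quantum group $U_q(\mathfrak{sl}_2)$. For $i\ge 0$ let $L(i)$ be the $(i+1)$-dimensional simple $U_q(\mathfrak{sl}_2)$-module with highest weight vector $v_i$ of weight $q^i$: it has basis $F^sv_i$ $(0\le s\le i)$, with $F^{i+1}v_i=0$, $KF^sv_i=q^{i-2s}F^sv_i$, $Ev_i=0$ and $EF^sv_i=[s][i-s+1]F^{s-1}v_i$ for $1\le s\le i$. Let $\mathcal A$ be the category of finite-dimensional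 $U_q(\mathfrak s)$-modules of type $1$ (that is, $K$ acts diagonalizably and all its eigenvalues are in $q^{\mathbb Z}$) on which $Z$ acts by zero, with all $U_q(\mathfrak s)$-module homomorphisms as morphisms. Let $\mathbf Q_\infty$ be the quiver with vertices $0,1,2,\dots$ and arrows $a_i:i\to i+1$, $b_i:i+1\to i$ $(i\ge 0)$. Let $\mathcal B$ be the category of finite-dimensional complex representations $(M_i,M(a_i),M(b_i))_{i\ge0}$ of $\mathbf Q_\infty$ (that is, $\dim\bigoplus_i M_i<\infty$) satisfying $$b_0a_0=0,\qquad a_ib_i=b_{i+1}a_{i+1}\quad(i\ge0).$$ **Theorem.** The categories $\mathcal A$ and $\mathcal B$ are equivalent. More precisely, there is an equivalence $\Phi:\mathcal A\to\mathcal B$ given, up to linear isomorphisms natural in $V$, by $\Phi(V)_i=V_i:=\operatorname{Hom}_{U_q(\mathfrak{sl}_2)}(L(i),V)$ on objects and $\Phi(f)_i(\theta)=f\circ\theta$ on morphisms, where the maps $V(a_i):V_i\to V_{i+1}$ and $V(b_i):V_{i+1}\to V_i$ are determined by $$\bigl(V(a_i)\theta\bigr)(v_{i+1})=X\,\theta(v_i)\quad(\theta\in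 V_i),\qquad \bigl(V(b_i)\theta\bigr)(v_i)=[i+1]\,Y\theta(v_{i+1})-q^{-1}XF\,\theta(v_{i+1})\quad(\theta\in V_{i+1}).$$ -/

import Mathlib

open CategoryTheory

universe u

noncomputable section

namespace QuantumSchrodinger

/-! ### The quantum Schrödinger algebra -/

/-- The generators `E, F, K, K⁻¹, X, Y, Z`. -/
inductive Gen : Type
  | E | F | K | Kinv | X | Y | Z

/-- The free algebra on the seven generators. -/
abbrev Free : Type := FreeAlgebra ℂ Gen

/-- A generator as an element of the free algebra. -/
abbrev g (x : Gen) : Free := FreeAlgebra.ι ℂ x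

/-- The defining relations of the quantum Schrödinger algebra `U_q(𝔰)`. -/
inductive Rel (q : ℂˣ) : Free → Free → Prop
  | K_Kinv : Rel q (g .K * g .Kinv) 1
  | Kinv_K : Rel q (g .Kinv * g .K) 1
  | E_F : Rel q (g .E * g .F - g .F * g .E)
      (((q : ℂ) - (q : ℂ)⁻¹)⁻¹ • (g .K - g .Kinv))
  | K_X : Rel q (g .K * g .X * g .Kinv) ((q : ℂ) • g .X)
  | K_E : Rel q (g .K * g .E * g .Kinv) ((q : ℂ) ^ 2 • g .E)
  | K_F : Rel q (g .K * g .F * g .Kinv) (((q : ℂ) ^ 2)⁻¹ • g .F)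
  | K_Y : Rel q (g .K * g .Y * g .Kinv) ((q : ℂ)⁻¹ • g .Y)
  | Y_X : Rel q ((q : ℂ) • (g .Y * g .X) - g .X * g .Y) (g .Z)
  | E_X : Rel q (g .E * g .X) ((q : ℂ) • (g .X * g .E))
  | E_Y : Rel q (g .E * g .Y) (g .X + (q : ℂ)⁻¹ • (g .Y * g .E))
  | F_X : Rel q (g .F * g .X) (g .Y * g .Kinv + g .X * g .F)
  | F_Y : Rel q (g .F * g .Y) (g .Y * g .F)
  | Z_central (x : Gen) : Rel q (g .Z * g x) (g x * g .Z)

/-- The quantum Schrödinger algebra `U_q(𝔰)` over `ℂ`. -/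
abbrev Uqs (q : ℂˣ) : Type := RingQuot (Rel q)

/-- The image of a generator in `U_q(𝔰)`. -/
def gen (q : ℂˣ) (x : Gen) : Uqs q := RingQuot.mkAlgHom ℂ (Rel q) (g x)

/-- The quantum group `U_q(𝔰𝔩₂)`, as the subalgebra of `U_q(𝔰)` generated by
`E, F, K, K⁻¹`. -/
def UqSl2 (q : ℂˣ) : Subalgebra ℂ (Uqs q) :=
  Algebra.adjoin ℂ {gen q .E, gen q .F, gen q .K, gen q .Kinv}

/-! ### The simple modules `L(i)` -/

/-- The quantum integer `[n] = (q ^ n - q ^ (-n)) / (q - q⁻¹)`. -/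
def qInt (q : ℂˣ) (n : ℤ) : ℂ :=
  ((q : ℂ) ^ n - (q : ℂ) ^ (-n)) / ((q : ℂ) - (q : ℂ)⁻¹)

/-- The underlying space of `L(i)`, with basis `v_i, F v_i, …, F ^ i v_i`: the value of
`f : L q i` at `s` is the coefficient of `F ^ s v_i`. -/
def L (_q : ℂˣ) (i : ℕ) : Type := Fin (i + 1) → ℂ

instance (q : ℂˣ) (i : ℕ) : AddCommGroup (L q i) :=
  inferInstanceAs (AddCommGroup (Fin (i + 1) → ℂ))

instance (q : ℂˣ) (i : ℕ) : Module ℂ (L q i) :=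
  inferInstanceAs (Module ℂ (Fin (i + 1) → ℂ))

namespace L

variable (q : ℂˣ) (i : ℕ)

/-- `K F^s v_i = q ^ (i - 2 s) F^s v_i`. -/
def opK : Module.End ℂ (L q i) where
  toFun f := fun s => (q : ℂ) ^ ((i : ℤ) - 2 * (s : ℕ)) * f s
  map_add' f f' := by funext s; exact mul_add _ _ _
  map_smul' c f := by funext s; exact mul_left_comm _ _ _

/-- `K⁻¹ F^s v_i = q ^ (-(i - 2 s)) F^s v_i`. -/
def opKinv : Module.End ℂ (L q i) where
  toFun f := fun s => (q : ℂ) ^ (-((i : ℤ) - 2 * (s : ℕ))) * f s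
  map_add' f f' := by funext s; exact mul_add _ _ _
  map_smul' c f := by funext s; exact mul_left_comm _ _ _

/-- `F F^s v_i = F^(s+1) v_i`, which is `0` for `s = i`. -/
def opF : Module.End ℂ (L q i) where
  toFun f := fun s => if h : 0 < (s : ℕ) then f ⟨s - 1, by omega⟩ else 0
  map_add' f f' := by
    funext s
    by_cases h : 0 < (s : ℕ)
    · simp only [dif_pos h]
      change _ = (dite _ _ _ : ℂ) + dite _ _ _
      rw [dif_pos h, dif_pos h]; rfl
    · simp only [dif_neg h]
      change _ = (dite _ _ _ : ℂ) + dite _ _ _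
      rw [dif_neg h, dif_neg h, add_zero]
  map_smul' c f := by
    funext s
    by_cases h : 0 < (s : ℕ)
    · simp only [dif_pos h]
      change _ = c * (dite _ _ _ : ℂ)
      rw [dif_pos h]; rfl
    · simp only [dif_neg h]
      change _ = c * (dite _ _ _ : ℂ)
      rw [dif_neg h, mul_zero]

/-- `E F^s v_i = [s] [i - s + 1] F^(s-1) v_i`. -/
def opE : Module.End ℂ (L q i) where
  toFun f := fun s =>
    if h : (s : ℕ) < i then qInt q ((s : ℕ) + 1) * qInt q ((i : ℤ) - (s : ℕ)) *
      f ⟨s + 1, by omega⟩ else 0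
  map_add' f f' := by
    funext s
    by_cases h : (s : ℕ) < i
    · simp only [dif_pos h]
      change _ = (dite _ _ _ : ℂ) + dite _ _ _
      rw [dif_pos h, dif_pos h]; exact mul_add _ _ _
    · simp only [dif_neg h]
      change _ = (dite _ _ _ : ℂ) + dite _ _ _
      rw [dif_neg h, dif_neg h, add_zero]
  map_smul' c f := by
    funext s
    by_cases h : (s : ℕ) < i
    · simp only [dif_pos h]
      change _ = c * (dite _ _ _ : ℂ)
      rw [dif_pos h]; exact mul_left_comm _ _ _
    · simp only [dif_neg h]
      change _ = c * (dite _ _ _ : ℂ)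
      rw [dif_neg h, mul_zero]

theorem opE_apply (f : L q i) (s : Fin (i + 1)) : opE q i f s =
    if h : (s : ℕ) < i then qInt q ((s : ℕ) + 1) * qInt q ((i : ℤ) - (s : ℕ)) *
      f ⟨s + 1, by omega⟩ else 0 := rfl

theorem opF_apply (f : L q i) (s : Fin (i + 1)) : opF q i f s =
    if h : 0 < (s : ℕ) then f ⟨s - 1, by omega⟩ else 0 := rfl

/-- The operators on `L(i)`. The module `L(i)` is regarded as a `U_q(𝔰)`-module on which
`X, Y, Z` act by zero; only its restriction to `U_q(𝔰𝔩₂)` matters. -/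
def op : Gen → Module.End ℂ (L q i)
  | .E => opE q i
  | .F => opF q i
  | .K => opK q i
  | .Kinv => opKinv q i
  | .X => 0
  | .Y => 0
  | .Z => 0

/-- The identity `[s+1][i-s] - [s][i-s+1] = [i-2s]`. -/
theorem qInt_identity (s n : ℤ) :
    qInt q (s + 1) * qInt q (n - s) - qInt q s * qInt q (n - s + 1) =
      ((q : ℂ) - (q : ℂ)⁻¹)⁻¹ * ((q : ℂ) ^ (n - 2 * s) - (q : ℂ) ^ (-(n - 2 * s))) := by
  have hq : (q : ℂ) ≠ 0 := q.ne_zero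
  unfold qInt
  by_cases hd : (q : ℂ) - (q : ℂ)⁻¹ = 0
  · simp [hd]
  have key : ((q : ℂ) ^ (s + 1) - (q : ℂ) ^ (-(s + 1))) * ((q : ℂ) ^ (n - s) - (q : ℂ) ^ (-(n - s)))
      - ((q : ℂ) ^ s - (q : ℂ) ^ (-s)) * ((q : ℂ) ^ (n - s + 1) - (q : ℂ) ^ (-(n - s + 1)))
      = ((q : ℂ) - (q : ℂ)⁻¹) * ((q : ℂ) ^ (n - 2 * s) - (q : ℂ) ^ (-(n - 2 * s))) := by
    have h1 : (q : ℂ) - (q : ℂ)⁻¹ = (q : ℂ) ^ (1 : ℤ) - (q : ℂ) ^ (-1 : ℤ) := by simp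
    rw [h1]
    simp only [sub_mul, mul_sub, ← zpow_add₀ hq]
    ring_nf
  rw [div_mul_div_comm, div_mul_div_comm, ← sub_div, key]
  field_simp

theorem op_rel ⦃x y : Free⦄ (h : Rel q x y) :
    FreeAlgebra.lift ℂ (op q i) x = FreeAlgebra.lift ℂ (op q i) y := by
  have hq : (q : ℂ) ≠ 0 := q.ne_zero
  cases h with
  | K_Kinv =>
    simp only [map_mul, map_one, FreeAlgebra.lift_ι_apply, op]
    refine LinearMap.ext fun f => funext fun s => ?_
    change _ * (_ * f s) = f s
    rw [← mul_assoc, ← zpow_add₀ hq, add_neg_cancel, zpow_zero, one_mul]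
  | Kinv_K =>
    simp only [map_mul, map_one, FreeAlgebra.lift_ι_apply, op]
    refine LinearMap.ext fun f => funext fun s => ?_
    change _ * (_ * f s) = f s
    rw [← mul_assoc, ← zpow_add₀ hq, neg_add_cancel, zpow_zero, one_mul]
  | E_F =>
    simp only [map_mul, map_sub, map_smul, FreeAlgebra.lift_ι_apply, op]
    refine LinearMap.ext fun f => funext fun s => ?_
    have hid := qInt_identity q (s : ℕ) i
    have e1 : opE q i (opF q i f) s =
        qInt q ((s : ℕ) + 1) * qInt q ((i : ℤ) - (s : ℕ)) * f s := by
      by_cases h : (s : ℕ) < i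
      · rw [opE_apply, dif_pos h, opF_apply, dif_pos (Nat.succ_pos _)]
        rfl
      · have h' : (s : ℕ) = i := by omega
        rw [opE_apply, dif_neg h, h']
        simp [qInt]
    have e2 : opF q i (opE q i f) s =
        qInt q (s : ℕ) * qInt q ((i : ℤ) - (s : ℕ) + 1) * f s := by
      by_cases h : 0 < (s : ℕ)
      · have h' : (s : ℕ) - 1 < i := by omega
        have hs : (⟨(s : ℕ) - 1 + 1, by omega⟩ : Fin (i + 1)) = s := Fin.ext (by simp; omega)
        rw [opF_apply, dif_pos h, opE_apply, dif_pos h']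
        simp only [hs]
        push_cast [Nat.cast_sub (show 1 ≤ (s : ℕ) from h)]
        congr 3 <;> ring_nf
      · have h' : (s : ℕ) = 0 := by omega
        rw [opF_apply, dif_neg h, h']
        simp [qInt]
    change opE q i (opF q i f) s - opF q i (opE q i f) s = _ * (_ * f s - _ * f s)
    rw [e1, e2, ← sub_mul, ← sub_mul, ← mul_assoc, ← hid]
  | K_X => simp [op]
  | K_E =>
    simp only [map_mul, map_smul, FreeAlgebra.lift_ι_apply, op]
    refine LinearMap.ext fun f => funext fun s => ?_
    change _ * opE q i (opKinv q i f) s = (q : ℂ) ^ 2 * opE q i f s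
    rw [opE_apply, opE_apply]
    by_cases h : (s : ℕ) < i
    · rw [dif_pos h, dif_pos h]
      change _ * (_ * ((q : ℂ) ^ (-((i : ℤ) - 2 * (((s : ℕ) + 1 : ℕ) : ℤ))) * _)) = _
      have : (q : ℂ) ^ ((i : ℤ) - 2 * (s : ℕ)) *
          (q : ℂ) ^ (-((i : ℤ) - 2 * (((s : ℕ) + 1 : ℕ) : ℤ))) = (q : ℂ) ^ 2 := by
        rw [← zpow_add₀ hq, ← zpow_natCast]
        congr 1
        push_cast
        ring
      rw [← this]
      ring
    · rw [dif_neg h, dif_neg h, mul_zero, mul_zero]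
  | K_F =>
    simp only [map_mul, map_smul, FreeAlgebra.lift_ι_apply, op]
    refine LinearMap.ext fun f => funext fun s => ?_
    change _ * opF q i (opKinv q i f) s = ((q : ℂ) ^ 2)⁻¹ * opF q i f s
    rw [opF_apply, opF_apply]
    by_cases h : 0 < (s : ℕ)
    · rw [dif_pos h, dif_pos h]
      change _ * ((q : ℂ) ^ (-((i : ℤ) - 2 * (((s : ℕ) - 1 : ℕ) : ℤ))) * _) = _
      have : (q : ℂ) ^ ((i : ℤ) - 2 * (s : ℕ)) *
          (q : ℂ) ^ (-((i : ℤ) - 2 * (((s : ℕ) - 1 : ℕ) : ℤ))) = ((q : ℂ) ^ 2)⁻¹ := by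
        rw [← zpow_add₀ hq, ← zpow_natCast, ← zpow_neg]
        congr 1
        push_cast [Nat.cast_sub (show 1 ≤ (s : ℕ) from h)]
        ring
      rw [← this]
      ring
    · rw [dif_neg h, dif_neg h, mul_zero, mul_zero]
  | K_Y => simp [op]
  | Y_X => simp [op]
  | E_X => simp [op]
  | E_Y => simp [op]
  | F_X => simp [op]
  | F_Y => simp [op]
  | Z_central x => simp [op]

/-- The representation of `U_q(𝔰)` on `L(i)`. -/
def rep : Uqs q →ₐ[ℂ] Module.End ℂ (L q i) :=
  RingQuot.liftAlgHom ℂ ⟨FreeAlgebra.lift ℂ (op q i), op_rel q i⟩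

instance : Module (Uqs q) (L q i) := Module.compHom (L q i) (rep q i).toRingHom

/-- The highest weight vector `v_i` of `L(i)`. -/
def v : L q i := fun s => if (s : ℕ) = 0 then 1 else 0

end L

/-! ### The category `𝒜` -/

open scoped ModuleCat

/-- The weight space `V_λ = {v | K v = λ v}`. -/
def weightSpace (q : ℂˣ) (V : ModuleCat.{u} (Uqs q)) (lam : ℂˣ) : Submodule ℂ V :=
  Module.End.eigenspace (Algebra.lsmul ℂ ℂ V (gen q .K)) (lam : ℂ)

/-- `K` acts diagonally: `V` is the (automatically direct) sum of its weight spaces. -/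
def IsWeight (q : ℂˣ) (V : ModuleCat.{u} (Uqs q)) : Prop :=
  ⨆ lam : ℂˣ, weightSpace q V lam = ⊤

/-- The set of weights of `V`. -/
def supp (q : ℂˣ) (V : ModuleCat.{u} (Uqs q)) : Set ℂˣ :=
  {lam | weightSpace q V lam ≠ ⊥}

/-- A module of type `1`: a weight module all of whose weights are integral powers of `q`. -/
def IsTypeOne (q : ℂˣ) (V : ModuleCat.{u} (Uqs q)) : Prop :=
  IsWeight q V ∧ supp q V ⊆ Set.range fun n : ℤ => q ^ n

/-- Finite-dimensional modules of type `1` on which `Z` acts by zero. -/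
def propA (q : ℂˣ) : ObjectProperty (ModuleCat.{u} (Uqs q)) := fun V =>
  Module.Finite ℂ V ∧ IsTypeOne q V ∧ ∀ w : V, gen q .Z • w = 0

/-- The category `𝒜`. -/
abbrev CatA (q : ℂˣ) := (propA.{u} q).FullSubcategory

/-! ### The quiver `Q_∞` and the category `ℬ` -/

/-- The vertices `0, 1, 2, …` of the quiver `Q_∞`. -/
structure QInf : Type where
  /-- The number of the vertex. -/
  idx : ℕ

/-- The arrows `a_i : i → i + 1` and `b_i : i + 1 → i` of `Q_∞`. -/
inductive QInf.Arrow : QInf → QInf → Type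
  | a (i : ℕ) : QInf.Arrow ⟨i⟩ ⟨i + 1⟩
  | b (i : ℕ) : QInf.Arrow ⟨i + 1⟩ ⟨i⟩

instance : Quiver QInf := ⟨QInf.Arrow⟩

/-- The category of all complex representations of `Q_∞`, as functors on the path category. -/
abbrev QRep := Paths QInf ⥤ ModuleCat.{u} ℂ

namespace QRep

/-- The space `M_i` at the vertex `i`. -/
abbrev space (M : QRep.{u}) (i : ℕ) : ModuleCat.{u} ℂ := M.obj ((Paths.of QInf).obj ⟨i⟩)

/-- The linear map `M(a_i) : M_i → M_{i+1}`. -/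
def a (M : QRep.{u}) (i : ℕ) : M.space i →ₗ[ℂ] M.space (i + 1) :=
  (M.map ((Paths.of QInf).map (QInf.Arrow.a i))).hom

/-- The linear map `M(b_i) : M_{i+1} → M_i`. -/
def b (M : QRep.{u}) (i : ℕ) : M.space (i + 1) →ₗ[ℂ] M.space i :=
  (M.map ((Paths.of QInf).map (QInf.Arrow.b i))).hom

/-- The relations `b_0 a_0 = 0` and `a_i b_i = b_{i+1} a_{i+1}`. -/
def SatisfiesRelations (M : QRep.{u}) : Prop :=
  M.b 0 ∘ₗ M.a 0 = 0 ∧ ∀ i : ℕ, M.a i ∘ₗ M.b i = M.b (i + 1) ∘ₗ M.a (i + 1)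

/-- Finite-dimensionality of the total space `⨁ i, M_i`: every `M_i` is finite-dimensional and
only finitely many of them are nonzero. -/
def IsFiniteDimensional (M : QRep.{u}) : Prop :=
  (∀ i : ℕ, Module.Finite ℂ (M.space i)) ∧ {i : ℕ | Nontrivial (M.space i)}.Finite

end QRep

/-- Finite-dimensional representations of `Q_∞` satisfying the relations. -/
def propB : ObjectProperty QRep.{u} := fun M =>
  M.IsFiniteDimensional ∧ M.SatisfiesRelations

/-- The category `ℬ`. -/
abbrev CatB := propB.{u}.FullSubcategory

/-- The linear map `f_i : M_i → N_i` that is the component at the vertex `i` of a morphism `f` of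
representations. -/
def CatB.component {M N : CatB.{u}} (f : M ⟶ N) (i : ℕ) :
    M.obj.space i →ₗ[ℂ] N.obj.space i :=
  (f.hom.app ((Paths.of QInf).obj ⟨i⟩)).hom

/-- The vector space `Hom_{U_q(𝔰𝔩₂)}(L(i), V)`. -/
abbrev HomL (q : ℂˣ) (V : ModuleCat.{u} (Uqs q)) (i : ℕ) : Type u :=
  L q i →ₗ[UqSl2 q] V

end QuantumSchrodinger

end

/-!
Write `V_i` for the space of highest weight vectors of weight `q ^ i` in `V`. A homomorphism
`L(i) → V` of `U_q(𝔰𝔩₂)`-modules is determined by the image of `v_i`, which may be any element of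
`V_i` (`homLEquiv`), so `Φ(V)` may be taken to be the quiver representation on the spaces `V_i` with
`a_i w = X w` and `b_i w = [i + 1] Y w - q⁻¹ X F w` (`hwFunctor`). The quiver relations are short
computations (`hwDown_hwUp_zero`, `hwUp_hwDown`).

Complete reducibility over `U_q(𝔰𝔩₂)` is needed only in the following form. If `v` has weight
`q ^ m` with `m ≥ 1` and `E ^ k` is the last power of `E` not killing `v`, then
`E ^ (k + 1) F v = [k + 1][m + k] E ^ k v ≠ 0`; so `E F` is injective, hence bijective, on the weight
spaces of positive weight. Symmetrically `F E` is bijective on those of negative weight. Therefore a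
weight space of weight `n ≥ 0` is the direct sum of `V_n` and the image of `F`, one of weight `n < 0`
lies in the image of `F`, a module is generated by its highest weight vectors
(`IsQTriple.eq_top_of_hwt_le`), and there is a projection `π_i : V → V_i` which kills the image of
`F` and the weight spaces of weight different from `i` (`IsQTriple.proj`).

Conversely, from a representation `M` of the quiver one builds a module `⨁ i, L(i) ⊗ M i`
(`Model.supported`). Its elements are families `f i s ∈ M i` indexed by `i : ℕ` and `s : ℤ` and
supported on `0 ≤ s ≤ i`, where `f i s` is the coefficient of a multiple `u_{i,s}` of `F ^ s v_i`. The
operators shift and rescale these families, with formulas in which the boundary of the support is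
respected because the quantum integers involved vanish there; the quiver relations say that the
operators of the `a_i` and of the `b_i` commute (`Model.down_up`), and the relations of `U_q(𝔰)` then
become identities between coefficients (`Model.isSchrodinger`). The highest weight vectors of this
module give back `M` (`Model.hwtEquiv`), so `Φ` is essentially surjective.

For a module `V`, the coefficients `π_i (E ^ s v) / [s]!` define a map from `V` to the module built
from `Φ(V)`. It commutes with all generators, since `π_i (X v)` and `π_i (Y v)` can be expressed by
`a`, `b` and the projections of `v` and `E v` (`proj_X`, `proj_Y`). It is injective because a nonzero
weight vector in its kernel could be raised to a nonzero highest weight vector in the kernel, and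
surjective because the image contains the generating highest weight vectors (`delta_injective`,
`delta_surjective`). Hence every morphism `Φ(V) → Φ(W)` lifts to a morphism `V → W`, and the lift is
unique because `V` is generated by its highest weight vectors.
-/

open CategoryTheory

noncomputable section

namespace QuantumSchrodinger

/-! ### Quantum integers -/

section QInt

variable {q : ℂˣ}

theorem zpow_injective_of_not_root (hq : ∀ n : ℕ, 0 < n → q ^ n ≠ 1) :
    Function.Injective fun n : ℤ => (q : ℂ) ^ n := by
  have key : ∀ n : ℤ, (q : ℂ) ^ n = 1 → n = 0 := by
    intro n hn
    have h1 : q ^ n = 1 := Units.ext (by simpa using hn)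
    by_contra h0
    refine hq n.natAbs (Int.natAbs_pos.mpr h0) ?_
    rcases Int.natAbs_eq n with h | h
    · rwa [h, zpow_natCast] at h1
    · rwa [h, zpow_neg, inv_eq_one, zpow_natCast] at h1
  intro m n hmn
  have : (q : ℂ) ^ (m - n) = 1 := by
    rw [zpow_sub₀ q.ne_zero]
    exact (div_eq_one_iff_eq (zpow_ne_zero _ q.ne_zero)).mpr hmn
  have := key _ this
  omega

theorem sub_inv_ne_zero (hq : ∀ n : ℕ, 0 < n → q ^ n ≠ 1) : (q : ℂ) - (q : ℂ)⁻¹ ≠ 0 := by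
  intro h
  have := zpow_injective_of_not_root hq (a₁ := 1) (a₂ := -1) (by
    simpa [sub_eq_zero] using h)
  omega

theorem qInt_ne_zero (hq : ∀ n : ℕ, 0 < n → q ^ n ≠ 1) {n : ℤ} (hn : n ≠ 0) :
    qInt q n ≠ 0 := by
  unfold qInt
  refine div_ne_zero ?_ (sub_inv_ne_zero hq)
  intro h
  have := zpow_injective_of_not_root hq (sub_eq_zero.mp h)
  omega

@[simp] theorem qInt_zero : qInt q 0 = 0 := by simp [qInt]

theorem qInt_one (hq : ∀ n : ℕ, 0 < n → q ^ n ≠ 1) : qInt q 1 = 1 := by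
  simp only [qInt, zpow_one, zpow_neg]
  exact div_self (sub_inv_ne_zero hq)

theorem qInt_neg (n : ℤ) : qInt q (-n) = -qInt q n := by
  simp only [qInt, neg_neg]; ring

theorem qInt_add_one (hq : ∀ n : ℕ, 0 < n → q ^ n ≠ 1) (n : ℤ) :
    qInt q (n + 1) = q * qInt q n + (q : ℂ) ^ (-n) := by
  have h0 := q.ne_zero
  have h1 := sub_inv_ne_zero hq
  have e : (q : ℂ) ^ (-(n + 1)) = (q : ℂ) ^ (-n) * (q : ℂ)⁻¹ := by
    rw [neg_add, zpow_add₀ h0]; simp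
  rw [qInt, qInt, e, zpow_add_one₀ h0, div_eq_iff h1, add_mul, mul_assoc, div_mul_cancel₀ _ h1]
  ring

theorem qInt_add_one' (hq : ∀ n : ℕ, 0 < n → q ^ n ≠ 1) (n : ℤ) :
    qInt q (n + 1) = (q : ℂ)⁻¹ * qInt q n + (q : ℂ) ^ n := by
  have h := qInt_add_one hq (-n - 1)
  rw [sub_add_cancel, show -n - 1 = -(n + 1) by ring, qInt_neg, qInt_neg, neg_neg,
    zpow_add_one₀ q.ne_zero] at h
  have h0 := q.ne_zero
  field_simp
  linear_combination h

/-- The identity behind the commutator `[E ^ (s + 1), F]`. -/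
theorem qInt_commutator (s m : ℤ) :
    qInt q s * qInt q (m + s + 1) + qInt q m = qInt q (s + 1) * qInt q (m + s) := by
  have h := L.qInt_identity q s (m + 2 * s)
  have e : ((q : ℂ) - (q : ℂ)⁻¹)⁻¹ * ((q : ℂ) ^ m - (q : ℂ) ^ (-m)) = qInt q m := by
    rw [qInt, div_eq_inv_mul]
  rw [show m + 2 * s - s = m + s by ring, show m + 2 * s - 2 * s = m by ring, e] at h
  linear_combination -h

/-- The quantum factorial `[s]! = [1][2]⋯[s]`. -/
def qFact (q : ℂˣ) : ℕ → ℂ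
  | 0 => 1
  | s + 1 => qInt q (s + 1) * qFact q s

end QInt

/-! ### Finite-dimensional weight representations of the quantum group -/

/-- Operators `E, F, K, K' = K⁻¹` on a vector space satisfying the defining relations of
`U_q(𝔰𝔩₂)`; in the last two relations `K⁻¹` has been moved to the other side. -/
structure IsQTriple (q : ℂˣ) {V : Type*} [AddCommGroup V] [Module ℂ V]
    (E F K K' : Module.End ℂ V) : Prop where
  K_Kinv : ∀ v, K (K' v) = v
  Kinv_K : ∀ v, K' (K v) = v
  comm : ∀ v, E (F v) - F (E v) = ((q : ℂ) - (q : ℂ)⁻¹)⁻¹ • (K v - K' v)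
  K_E : ∀ v, K (E v) = (q : ℂ) ^ (2 : ℤ) • E (K v)
  K_F : ∀ v, K (F v) = (q : ℂ) ^ (-2 : ℤ) • F (K v)

/-- The eigenspace of `K` for the eigenvalue `q ^ n`. -/
def wt (q : ℂˣ) {V : Type*} [AddCommGroup V] [Module ℂ V] (K : Module.End ℂ V) (n : ℤ) :
    Submodule ℂ V :=
  Module.End.eigenspace K ((q : ℂ) ^ n)

/-- The space of highest weight vectors of weight `q ^ n`. -/
def hwt (q : ℂˣ) {V : Type*} [AddCommGroup V] [Module ℂ V] (E K : Module.End ℂ V) (n : ℤ) :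
    Submodule ℂ V :=
  wt q K n ⊓ LinearMap.ker E

section Triple

variable {q : ℂˣ} {V : Type*} [AddCommGroup V] [Module ℂ V] {E F K K' : Module.End ℂ V}

theorem mem_wt {n : ℤ} {v : V} : v ∈ wt q K n ↔ K v = (q : ℂ) ^ n • v :=
  Module.End.mem_eigenspace_iff

theorem mem_hwt {n : ℤ} {v : V} : v ∈ hwt q E K n ↔ K v = (q : ℂ) ^ n • v ∧ E v = 0 := by
  rw [hwt, Submodule.mem_inf, mem_wt, LinearMap.mem_ker]

theorem wt_iSupIndep (hq : ∀ n : ℕ, 0 < n → q ^ n ≠ 1) (K : Module.End ℂ V) :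
    iSupIndep (wt q K) :=
  (Module.End.eigenspaces_iSupIndep K).comp (zpow_injective_of_not_root hq)

/-- Linear maps out of a weight module may be compared on weight vectors. -/
theorem ext_of_wt {W : Type*} [AddCommGroup W] [Module ℂ W] (htop : ⨆ n : ℤ, wt q K n = ⊤)
    {f g : V →ₗ[ℂ] W} (h : ∀ (n : ℤ), ∀ v ∈ wt q K n, f v = g v) (v : V) : f v = g v := by
  have hv : v ∈ ⨆ n : ℤ, wt q K n := htop ▸ Submodule.mem_top
  induction hv using Submodule.iSup_induction' with
  | mem n v hv => exact h n v hv
  | zero => simp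
  | add x y _ _ hx hy => rw [map_add, map_add, hx, hy]

theorem eigenspace_eq_bot (htop : ⨆ n : ℤ, wt q K n = ⊤) {μ : ℂ}
    (hμ : ∀ n : ℤ, (q : ℂ) ^ n ≠ μ) : Module.End.eigenspace K μ = ⊥ := by
  have h1 : (⊤ : Submodule ℂ V) ≤ ⨆ (ν : ℂ) (_ : ν ≠ μ), Module.End.eigenspace K ν := by
    rw [← htop]
    exact iSup_le fun n => le_iSup₂_of_le ((q : ℂ) ^ n) (hμ n) le_rfl
  have h2 := (Module.End.eigenspaces_iSupIndep K) μ
  rwa [top_le_iff.mp h1, disjoint_top] at h2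

/-- Only finitely many integers are weights of a finite-dimensional module. -/
theorem exists_wt_bound [Module.Finite ℂ V] (hq : ∀ n : ℕ, 0 < n → q ^ n ≠ 1)
    (K : Module.End ℂ V) : ∃ B : ℕ, ∀ n : ℤ, B < n.natAbs → wt q K n = ⊥ := by
  have h1 : {n : ℤ | K.HasEigenvalue ((q : ℂ) ^ n)}.Finite :=
    (Module.End.finite_hasEigenvalue K).preimage ((zpow_injective_of_not_root hq).injOn)
  obtain ⟨B, hB⟩ := (h1.image Int.natAbs).bddAbove
  refine ⟨B, fun n hn => ?_⟩
  by_contra h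
  have : n.natAbs ≤ B := hB ⟨n, h, rfl⟩
  omega

namespace IsQTriple

/-- The relations are symmetric under `E ↔ F`, `K ↔ K⁻¹`. -/
theorem symm (h : IsQTriple q E F K K') : IsQTriple q F E K' K where
  K_Kinv := h.Kinv_K
  Kinv_K := h.K_Kinv
  comm v := by
    rw [← neg_sub, h.comm, ← smul_neg, neg_sub]
  K_E v := by
    have h1 := h.K_F (K' v)
    rw [h.K_Kinv] at h1
    have h2 := congrArg K' h1
    rw [h.Kinv_K, map_smul] at h2
    rw [h2, smul_smul, ← zpow_add₀ q.ne_zero]; simp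
  K_F v := by
    have h1 := h.K_E (K' v)
    rw [h.K_Kinv] at h1
    have h2 := congrArg K' h1
    rw [h.Kinv_K, map_smul] at h2
    rw [h2, smul_smul, ← zpow_add₀ q.ne_zero]; simp

theorem Kinv_of_wt (h : IsQTriple q E F K K') {n : ℤ} {v : V} (hv : v ∈ wt q K n) :
    K' v = (q : ℂ) ^ (-n) • v := by
  have h1 := congrArg K' (mem_wt.mp hv)
  rw [h.Kinv_K, map_smul] at h1
  rw [h1, smul_smul, ← zpow_add₀ q.ne_zero, neg_add_cancel, zpow_zero, one_smul, ← h1]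

theorem wt_symm (h : IsQTriple q E F K K') (n : ℤ) : wt q K' n = wt q K (-n) := by
  ext v
  constructor
  · exact fun hv => mem_wt.mpr (h.symm.Kinv_of_wt hv)
  · exact fun hv => mem_wt.mpr (by rw [h.Kinv_of_wt hv, neg_neg])

theorem E_mem (h : IsQTriple q E F K K') {n : ℤ} {v : V} (hv : v ∈ wt q K n) :
    E v ∈ wt q K (n + 2) := by
  rw [mem_wt] at hv ⊢
  rw [h.K_E, hv, map_smul, smul_smul, ← zpow_add₀ q.ne_zero, add_comm]

theorem F_mem (h : IsQTriple q E F K K') {n : ℤ} {v : V} (hv : v ∈ wt q K n) :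
    F v ∈ wt q K (n - 2) := by
  rw [mem_wt] at hv ⊢
  rw [h.K_F, hv, map_smul, smul_smul, ← zpow_add₀ q.ne_zero, add_comm, sub_eq_add_neg]

theorem E_pow_mem (h : IsQTriple q E F K K') {n : ℤ} {v : V} (hv : v ∈ wt q K n) (k : ℕ) :
    (E ^ k) v ∈ wt q K (n + 2 * k) := by
  induction k with
  | zero => simpa using hv
  | succ k ih =>
    rw [pow_succ', Module.End.mul_apply]
    convert! h.E_mem ih using 2
    push_cast; ring

theorem F_pow_mem (h : IsQTriple q E F K K') {n : ℤ} {v : V} (hv : v ∈ wt q K n) (k : ℕ) :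
    (F ^ k) v ∈ wt q K (n - 2 * k) := by
  induction k with
  | zero => simpa using hv
  | succ k ih =>
    rw [pow_succ', Module.End.mul_apply]
    convert! h.F_mem ih using 2
    push_cast; ring

theorem E_F (h : IsQTriple q E F K K') {n : ℤ} {v : V} (hv : v ∈ wt q K n) :
    E (F v) = F (E v) + qInt q n • v := by
  have h1 := h.comm v
  rw [mem_wt.mp hv, h.Kinv_of_wt hv, ← sub_smul, smul_smul, ← div_eq_inv_mul] at h1
  rw [← sub_eq_iff_eq_add', h1, qInt]

theorem E_pow_F (hq : ∀ n : ℕ, 0 < n → q ^ n ≠ 1) (h : IsQTriple q E F K K') (s : ℕ) {m : ℤ}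
    {v : V} (hv : v ∈ wt q K m) :
    (E ^ (s + 1)) (F v) =
      F ((E ^ (s + 1)) v) + (qInt q (s + 1) * qInt q (m + s)) • (E ^ s) v := by
  induction s generalizing m v with
  | zero =>
    simp only [zero_add, pow_one, pow_zero, Module.End.one_apply, Nat.cast_zero, add_zero]
    rw [h.E_F hv, qInt_one hq, one_mul]
  | succ s ih =>
    rw [pow_succ, Module.End.mul_apply, h.E_F hv, map_add, ih (h.E_mem hv), map_smul, add_assoc]
    rw [← Module.End.mul_apply (E ^ (s + 1)) E v, ← Module.End.mul_apply (E ^ s) E v,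
      ← pow_succ, ← pow_succ, ← add_smul]
    congr 2
    have := qInt_commutator (q := q) (s + 1) m
    push_cast
    rw [← this]
    ring_nf

theorem E_F_pow (hq : ∀ n : ℕ, 0 < n → q ^ n ≠ 1) (h : IsQTriple q E F K K') (s : ℕ) {m : ℤ}
    {v : V} (hv : v ∈ wt q K m) :
    E ((F ^ (s + 1)) v) =
      (F ^ (s + 1)) (E v) + (qInt q (s + 1) * qInt q (m - s)) • (F ^ s) v := by
  have h1 := h.symm.E_pow_F hq s (m := -m) (v := v) (by rwa [h.wt_symm, neg_neg])
  rw [show -m + (s : ℤ) = -(m - s) by ring, qInt_neg] at h1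
  rw [h1]
  module

variable [Module.Finite ℂ V]

theorem exists_E_pow_eq_zero (hq : ∀ n : ℕ, 0 < n → q ^ n ≠ 1) (h : IsQTriple q E F K K')
    {m : ℤ} {v : V} (hv : v ∈ wt q K m) : ∃ k : ℕ, (E ^ k) v = 0 := by
  obtain ⟨B, hB⟩ := exists_wt_bound hq K
  refine ⟨B + m.natAbs + 1, ?_⟩
  have h1 := h.E_pow_mem hv (B + m.natAbs + 1)
  rwa [hB _ (by omega), Submodule.mem_bot] at h1

/-- A nonzero weight vector is moved by some power of `E` to a nonzero vector killed by `E`. -/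
theorem exists_E_pow_ne_zero (hq : ∀ n : ℕ, 0 < n → q ^ n ≠ 1) (h : IsQTriple q E F K K')
    {m : ℤ} {v : V} (hv : v ∈ wt q K m) (h0 : v ≠ 0) :
    ∃ k : ℕ, (E ^ k) v ≠ 0 ∧ (E ^ (k + 1)) v = 0 := by
  classical
  have hex := h.exists_E_pow_eq_zero hq hv
  have hpos : Nat.find hex ≠ 0 := by
    intro hz
    have := Nat.find_spec hex
    rw [hz] at this
    exact h0 (by simpa using this)
  obtain ⟨k, hk⟩ := Nat.exists_eq_succ_of_ne_zero hpos
  refine ⟨k, Nat.find_min hex (by omega), ?_⟩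
  rw [← Nat.succ_eq_add_one, ← hk]
  exact Nat.find_spec hex

/-- There are no highest weight vectors of negative weight: the vectors `F ^ s w` would all be
nonzero, because `[s + 1][n - s]` never vanishes. -/
theorem hwt_neg (hq : ∀ n : ℕ, 0 < n → q ^ n ≠ 1) (h : IsQTriple q E F K K') {n : ℤ}
    (hn : n < 0) {w : V} (hw : w ∈ hwt q E K n) : w = 0 := by
  obtain ⟨k, hk⟩ := h.symm.exists_E_pow_eq_zero hq (m := -n) (v := w)
    (by rw [h.wt_symm, neg_neg]; exact hw.1)
  induction k with
  | zero => simpa using hk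
  | succ k ih =>
    apply ih
    have h1 := h.E_F_pow hq k hw.1
    rw [hk, map_zero, (mem_hwt.mp hw).2, map_zero, zero_add, eq_comm, smul_eq_zero] at h1
    exact h1.resolve_left (mul_ne_zero (qInt_ne_zero hq (by omega)) (qInt_ne_zero hq (by omega)))

theorem F_pow_hwt (hq : ∀ n : ℕ, 0 < n → q ^ n ≠ 1) (h : IsQTriple q E F K K') {i : ℕ}
    {w : V} (hw : w ∈ hwt q E K i) : (F ^ (i + 1)) w = 0 := by
  have h1 := h.E_F_pow hq i hw.1
  rw [(mem_hwt.mp hw).2, map_zero, sub_self, qInt_zero, mul_zero, zero_smul, zero_add] at h1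
  have h2 := h.F_pow_mem hw.1 (i + 1)
  refine h.hwt_neg hq (n := (i : ℤ) - 2 * ((i + 1 : ℕ) : ℤ)) (by push_cast; omega) ⟨h2, h1⟩

/-- On weight spaces of positive weight `E F` is injective: if `E ^ k` is the last power of `E` not
killing `v`, then `E ^ (k + 1) F v = [k + 1][m + k] E ^ k v`. -/
theorem eq_zero_of_E_F (hq : ∀ n : ℕ, 0 < n → q ^ n ≠ 1) (h : IsQTriple q E F K K') {m : ℤ}
    (hm : 1 ≤ m) {v : V} (hv : v ∈ wt q K m) (h0 : E (F v) = 0) : v = 0 := by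
  by_contra hne
  obtain ⟨k, hk, hk'⟩ := h.exists_E_pow_ne_zero hq hv hne
  have h1 := h.E_pow_F hq k hv
  rw [hk', map_zero, zero_add, pow_succ, Module.End.mul_apply, h0, map_zero, eq_comm,
    smul_eq_zero] at h1
  exact h1.elim (mul_ne_zero (qInt_ne_zero hq (by omega)) (qInt_ne_zero hq (by omega))) hk

theorem exists_E_F_eq (hq : ∀ n : ℕ, 0 < n → q ^ n ≠ 1) (h : IsQTriple q E F K K') {m : ℤ}
    (hm : 1 ≤ m) {v : V} (hv : v ∈ wt q K m) : ∃ y ∈ wt q K m, E (F y) = v := by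
  have hstab : ∀ y ∈ wt q K m, (E ∘ₗ F) y ∈ wt q K m := fun y hy => by
    simpa using h.E_mem (h.F_mem hy)
  have hinj : Function.Injective ((E ∘ₗ F).restrict hstab) := by
    rw [← LinearMap.ker_eq_bot, LinearMap.ker_eq_bot']
    rintro ⟨y, hy⟩ hy0
    exact Subtype.ext (h.eq_zero_of_E_F hq hm hy (congrArg Subtype.val hy0))
  obtain ⟨⟨y, hy⟩, hyv⟩ := LinearMap.surjective_of_injective hinj ⟨v, hv⟩
  exact ⟨y, hy, congrArg Subtype.val hyv⟩

/-- A vector of weight `n ≥ 0` is the sum of a highest weight vector and a vector in the image of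
`F`. -/
theorem exists_eq_add_F (hq : ∀ n : ℕ, 0 < n → q ^ n ≠ 1) (h : IsQTriple q E F K K') {n : ℤ}
    (hn : 0 ≤ n) {v : V} (hv : v ∈ wt q K n) :
    ∃ w ∈ hwt q E K n, ∃ y ∈ wt q K (n + 2), v = w + F y := by
  obtain ⟨y, hy, hyv⟩ := h.exists_E_F_eq hq (by omega) (h.E_mem hv)
  have hFy : F y ∈ wt q K n := by simpa using h.F_mem hy
  refine ⟨v - F y, ⟨sub_mem hv hFy, LinearMap.mem_ker.mpr ?_⟩, y, hy, by simp⟩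
  rw [map_sub, hyv, sub_self]

theorem exists_eq_F (hq : ∀ n : ℕ, 0 < n → q ^ n ≠ 1) (h : IsQTriple q E F K K') {n : ℤ}
    (hn : n < 0) {v : V} (hv : v ∈ wt q K n) : ∃ y ∈ wt q K (n + 2), v = F y := by
  obtain ⟨y, hy, hyv⟩ := h.symm.exists_E_F_eq hq (m := -n) (by omega) (v := v)
    (by rwa [h.wt_symm, neg_neg])
  rw [h.wt_symm, neg_neg] at hy
  exact ⟨E y, h.E_mem hy, hyv.symm⟩

/-- A finite-dimensional module of type `1` is generated by its highest weight vectors. -/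
theorem eq_top_of_hwt_le (hq : ∀ n : ℕ, 0 < n → q ^ n ≠ 1) (h : IsQTriple q E F K K')
    (htop : ⨆ n : ℤ, wt q K n = ⊤) {N : Submodule ℂ V} (hN : ∀ i : ℕ, hwt q E K i ≤ N)
    (hF : ∀ v ∈ N, F v ∈ N) : N = ⊤ := by
  obtain ⟨B, hB⟩ := exists_wt_bound hq K
  rw [eq_top_iff, ← htop]
  refine iSup_le fun n => ?_
  -- downward induction on the weight, starting above all weights of `V`
  obtain ⟨k, hk⟩ : ∃ k : ℕ, (B : ℤ) < n + k := ⟨B + n.natAbs + 1, by omega⟩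
  induction k using Nat.strong_induction_on generalizing n with
  | _ k ih =>
    by_cases hBn : (B : ℤ) < n
    · rw [hB n (by omega)]; exact bot_le
    · have hk2 : wt q K (n + 2) ≤ N := ih (k - 1) (by omega) (n + 2) (by omega)
      intro v hv
      rcases lt_or_ge n 0 with hn | hn
      · obtain ⟨y, hy, rfl⟩ := h.exists_eq_F hq hn hv
        exact hF y (hk2 hy)
      · obtain ⟨w, hw, y, hy, rfl⟩ := h.exists_eq_add_F hq hn hv
        lift n to ℕ using hn
        exact add_mem (hN n hw) (hF y (hk2 hy))

/-- The highest weight vectors of weight `i` are complemented by the weight spaces of the other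
weights together with the vectors `F y` of weight `i`. -/
theorem isCompl_hwt (hq : ∀ n : ℕ, 0 < n → q ^ n ≠ 1) (h : IsQTriple q E F K K')
    (htop : ⨆ n : ℤ, wt q K n = ⊤) (i : ℕ) :
    IsCompl (hwt q E K i) ((wt q K (i + 2)).map F ⊔ ⨆ (n : ℤ) (_ : n ≠ i), wt q K n) := by
  constructor
  · rw [Submodule.disjoint_def]
    intro w hw hw'
    obtain ⟨_, ⟨y, hy, rfl⟩, c, hc, hwc⟩ := Submodule.mem_sup.mp hw'
    have hFy : F y ∈ wt q K i := by simpa using h.F_mem hy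
    have hc' : c = w - F y := by rw [← hwc]; simp
    have hc0 : c = 0 := by
      refine (Submodule.disjoint_def.mp (wt_iSupIndep hq K (i : ℤ))) c ?_ hc
      rw [hc']; exact sub_mem hw.1 hFy
    rw [hc0, add_zero] at hwc
    have hy0 : y = 0 := h.eq_zero_of_E_F hq (by omega) hy (by rw [hwc]; exact hw.2)
    rw [← hwc, hy0, map_zero]
  · rw [codisjoint_iff, eq_top_iff, ← htop]
    refine iSup_le fun n => ?_
    by_cases hn : n = i
    · subst hn
      intro v hv
      obtain ⟨w, hw, y, hy, rfl⟩ := h.exists_eq_add_F hq (by omega) hv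
      exact add_mem (Submodule.mem_sup_left hw)
        (Submodule.mem_sup_right (Submodule.mem_sup_left ⟨y, hy, rfl⟩))
    · exact le_sup_of_le_right (le_sup_of_le_right (le_iSup₂_of_le n hn le_rfl))

/-- The projection of `V` onto the highest weight vectors of weight `i` which kills the image of `F`
and all weight spaces of weight different from `i`. -/
def proj (hq : ∀ n : ℕ, 0 < n → q ^ n ≠ 1) (h : IsQTriple q E F K K')
    (htop : ⨆ n : ℤ, wt q K n = ⊤) (i : ℕ) : V →ₗ[ℂ] hwt q E K i :=
  (hwt q E K i).projectionOnto _ (h.isCompl_hwt hq htop i)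

section proj

variable (hq : ∀ n : ℕ, 0 < n → q ^ n ≠ 1) (h : IsQTriple q E F K K')
  (htop : ⨆ n : ℤ, wt q K n = ⊤) (i : ℕ)

@[simp] theorem proj_hwt (w : hwt q E K i) : h.proj hq htop i (w : V) = w :=
  Submodule.projectionOnto_apply_left _ w

theorem proj_of_ne {n : ℤ} (hn : n ≠ i) {v : V} (hv : v ∈ wt q K n) :
    h.proj hq htop i v = 0 :=
  Submodule.projectionOnto_apply_of_mem_right _
    (Submodule.mem_sup_right (Submodule.mem_iSup_of_mem n (Submodule.mem_iSup_of_mem hn hv)))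

theorem proj_F (v : V) : h.proj hq htop i (F v) = 0 := by
  refine ext_of_wt htop (f := h.proj hq htop i ∘ₗ F) (g := 0) (fun n v hv => ?_) v
  by_cases hn : n = i + 2
  · exact Submodule.projectionOnto_apply_of_mem_right _
      (Submodule.mem_sup_left ⟨v, hn ▸ hv, rfl⟩)
  · exact h.proj_of_ne hq htop i (n := n - 2) (by omega) (h.F_mem hv)

end proj

end IsQTriple

end Triple

theorem sq_sub_one_ne_zero {q : ℂˣ} (hq : ∀ n : ℕ, 0 < n → q ^ n ≠ 1) : (q : ℂ) ^ 2 - 1 ≠ 0 := by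
  intro h
  exact hq 2 two_pos (Units.ext (by simpa [sub_eq_zero] using h))

/-! ### Six operators satisfying the relations of the quantum Schrödinger algebra -/

/-- Operators `E, F, K, K⁻¹, X, Y` satisfying the defining relations of `U_q(𝔰)` with `Z = 0`. -/
structure IsSchrodinger (q : ℂˣ) {V : Type*} [AddCommGroup V] [Module ℂ V]
    (E F K K' X Y : Module.End ℂ V) : Prop extends IsQTriple q E F K K' where
  K_X : ∀ v, K (X v) = (q : ℂ) • X (K v)
  K_Y : ∀ v, K (Y v) = (q : ℂ)⁻¹ • Y (K v)
  E_X : ∀ v, E (X v) = (q : ℂ) • X (E v)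
  E_Y : ∀ v, E (Y v) = X v + (q : ℂ)⁻¹ • Y (E v)
  F_X : ∀ v, F (X v) = Y (K' v) + X (F v)
  F_Y : ∀ v, F (Y v) = Y (F v)
  X_Y : ∀ v, X (Y v) = (q : ℂ) • Y (X v)

/-! ### Operators on families of vectors in a quiver representation -/

namespace Model

section Ops

variable (q : ℂˣ) (M : ℕ → Type u) [∀ i, AddCommGroup (M i)] [∀ i, Module ℂ (M i)]

/-- The operator with weight function `c` and shift `d` on families `f i s`: it multiplies
`f i (s + d)` by `c i s`. -/
def diag (c : ℤ → ℤ → ℂ) (d : ℤ) : Module.End ℂ (∀ i, ℤ → M i) where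
  toFun f := fun i s => c i s • f i (s + d)
  map_add' f g := by funext i s; exact smul_add _ _ _
  map_smul' r f := by funext i s; exact smul_comm _ _ _

variable {M}

/-- The maps `a i : M i → M (i + 1)` as one operator, raising the index `i`. -/
def up (a : ∀ i, M i →ₗ[ℂ] M (i + 1)) : Module.End ℂ (∀ i, ℤ → M i) where
  toFun f := fun
    | 0, _ => 0
    | i + 1, s => a i (f i s)
  map_add' f g := by
    funext i s
    cases i with
    | zero => exact (add_zero _).symm
    | succ i => exact map_add _ _ _
  map_smul' r f := by
    funext i s
    cases i with
    | zero => exact (smul_zero (M := ℂ) (A := M 0) _).symm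
    | succ i => exact map_smul _ _ _

/-- The maps `b i : M (i + 1) → M i` as one operator, lowering the index `i`. -/
def down (b : ∀ i, M (i + 1) →ₗ[ℂ] M i) : Module.End ℂ (∀ i, ℤ → M i) where
  toFun f := fun i s => b i (f (i + 1) s)
  map_add' f g := by funext i s; exact map_add _ _ _
  map_smul' r f := by funext i s; exact map_smul _ _ _

variable (a : ∀ i, M i →ₗ[ℂ] M (i + 1)) (b : ∀ i, M (i + 1) →ₗ[ℂ] M i)

@[simp] theorem diag_apply (c : ℤ → ℤ → ℂ) (d : ℤ) (f : ∀ i, ℤ → M i) (i : ℕ) (s : ℤ) :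
    diag M c d f i s = c i s • f i (s + d) := rfl

@[simp] theorem up_zero (f : ∀ i, ℤ → M i) (s : ℤ) : up a f 0 s = 0 := rfl

@[simp] theorem up_succ (f : ∀ i, ℤ → M i) (i : ℕ) (s : ℤ) : up a f (i + 1) s = a i (f i s) := rfl

@[simp] theorem down_apply (f : ∀ i, ℤ → M i) (i : ℕ) (s : ℤ) :
    down b f i s = b i (f (i + 1) s) := rfl

theorem up_diag (c : ℤ → ℤ → ℂ) (d : ℤ) (f : ∀ i, ℤ → M i) (i : ℕ) (s : ℤ) :
    up a (diag M c d f) i s = c (i - 1) s • up a f i (s + d) := by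
  cases i with
  | zero => simp
  | succ i => simp

/-- The quiver relations say that the operators `up` and `down` commute; the relation `b_0 a_0 = 0`
is the component at `i = 0`, where `up` is zero. -/
theorem down_up {a b} (h0 : b 0 ∘ₗ a 0 = 0)
    (h : ∀ i, a i ∘ₗ b i = b (i + 1) ∘ₗ a (i + 1)) (f : ∀ i, ℤ → M i) :
    down b (up a f) = up a (down b f) := by
  funext i s
  cases i with
  | zero => exact LinearMap.congr_fun h0 (f 0 s)
  | succ i => exact (LinearMap.congr_fun (h i) (f (i + 1) s)).symm

variable (M)

/-- The action of `E`. A family `f` supported on `0 ≤ s ≤ i` stands for `∑ u_{i,s} ⊗ f i s`, where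
`u_{i,0} = v_i`, `E u_{i,s} = [s] u_{i,s-1}` and `F u_{i,s} = [i - s] u_{i,s+1}`; the vector `u_{i,s}`
is a multiple of `F ^ s v_i`. The formulas make sense, and satisfy the relations, for all families. -/
def opE : Module.End ℂ (∀ i, ℤ → M i) := diag M (fun _ s => qInt q (s + 1)) 1

/-- The action of `F`. -/
def opF : Module.End ℂ (∀ i, ℤ → M i) := diag M (fun i s => qInt q (i - s + 1)) (-1)

/-- The action of `K`. -/
def opK : Module.End ℂ (∀ i, ℤ → M i) := diag M (fun i s => (q : ℂ) ^ (i - 2 * s)) 0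

/-- The action of `K⁻¹`. -/
def opK' : Module.End ℂ (∀ i, ℤ → M i) := diag M (fun i s => (q : ℂ) ^ (-(i - 2 * s))) 0

variable {M}

/-- The action of `X`: on generators, `X (u_{i,s} ⊗ m)` is
`q ^ s u_{i+1,s} ⊗ a m - q ^ (s-i) [s] / ([i][i+1]) u_{i-1,s-1} ⊗ b m`, where the second
term is absent for `i = 0`. -/
def opX : Module.End ℂ (∀ i, ℤ → M i) :=
  diag M (fun _ s => (q : ℂ) ^ s) 0 * up a -
    diag M (fun i s => (q : ℂ) ^ (s - i) * qInt q (s + 1) / (qInt q (i + 1) * qInt q (i + 2))) 1 *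
      down b

/-- The action of `Y`: on generators, `Y (u_{i,s} ⊗ m)` is
`u_{i+1,s+1} ⊗ a m + q [i-s] / ([i][i+1]) u_{i-1,s} ⊗ b m`, where the second term is
absent for `i = 0`. -/
def opY : Module.End ℂ (∀ i, ℤ → M i) :=
  diag M (fun _ _ => 1) (-1) * up a +
    diag M (fun i s => q * qInt q (i + 1 - s) / (qInt q (i + 1) * qInt q (i + 2))) 0 * down b

theorem opE_apply (f : ∀ i, ℤ → M i) (i : ℕ) (s : ℤ) :
    opE q M f i s = qInt q (s + 1) • f i (s + 1) := rfl

theorem opF_apply (f : ∀ i, ℤ → M i) (i : ℕ) (s : ℤ) :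
    opF q M f i s = qInt q (i - s + 1) • f i (s - 1) := rfl

theorem opK_apply (f : ∀ i, ℤ → M i) (i : ℕ) (s : ℤ) :
    opK q M f i s = (q : ℂ) ^ (i - 2 * s) • f i s := by simp [opK]

theorem opK'_apply (f : ∀ i, ℤ → M i) (i : ℕ) (s : ℤ) :
    opK' q M f i s = (q : ℂ) ^ (-(i - 2 * s)) • f i s := by simp [opK']

theorem opX_apply (f : ∀ i, ℤ → M i) (i : ℕ) (s : ℤ) :
    opX q a b f i s = (q : ℂ) ^ s • up a f i s -
      ((q : ℂ) ^ (s - i) * qInt q (s + 1) / (qInt q (i + 1) * qInt q (i + 2))) •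
        down b f i (s + 1) := by
  simp [opX, Pi.sub_apply]

theorem opY_apply (f : ∀ i, ℤ → M i) (i : ℕ) (s : ℤ) :
    opY q a b f i s = up a f i (s - 1) +
      (q * qInt q (i + 1 - s) / (qInt q (i + 1) * qInt q (i + 2))) • down b f i s := by
  simp [opY, Pi.add_apply, sub_eq_add_neg]

theorem up_opE (f : ∀ i, ℤ → M i) (i : ℕ) (s : ℤ) :
    up a (opE q M f) i s = qInt q (s + 1) • up a f i (s + 1) := up_diag _ _ _ _ _ _

theorem up_opF (f : ∀ i, ℤ → M i) (i : ℕ) (s : ℤ) :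
    up a (opF q M f) i s = qInt q (i - 1 - s + 1) • up a f i (s - 1) := up_diag _ _ _ _ _ _

theorem up_opK (f : ∀ i, ℤ → M i) (i : ℕ) (s : ℤ) :
    up a (opK q M f) i s = (q : ℂ) ^ ((i : ℤ) - 1 - 2 * s) • up a f i s := by
  simp [opK, up_diag]

theorem up_opK' (f : ∀ i, ℤ → M i) (i : ℕ) (s : ℤ) :
    up a (opK' q M f) i s = (q : ℂ) ^ (-((i : ℤ) - 1 - 2 * s)) • up a f i s := by
  simp [opK', up_diag]

theorem up_opX (f : ∀ i, ℤ → M i) (i : ℕ) (s : ℤ) :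
    up a (opX q a b f) i s = (q : ℂ) ^ s • up a (up a f) i s -
      ((q : ℂ) ^ (s - (i - 1)) * qInt q (s + 1) / (qInt q (i - 1 + 1) * qInt q (i - 1 + 2))) •
        up a (down b f) i (s + 1) := by
  simp only [opX, LinearMap.sub_apply, map_sub, Pi.sub_apply, Module.End.mul_apply, up_diag,
    add_zero]

theorem up_opY (f : ∀ i, ℤ → M i) (i : ℕ) (s : ℤ) :
    up a (opY q a b f) i s = up a (up a f) i (s - 1) +
      (q * qInt q (i - 1 + 1 - s) / (qInt q (i - 1 + 1) * qInt q (i - 1 + 2))) •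
        up a (down b f) i s := by
  simp only [opY, LinearMap.add_apply, map_add, Pi.add_apply, Module.End.mul_apply, up_diag,
    add_zero, one_smul, sub_eq_add_neg]

theorem down_opX (f : ∀ i, ℤ → M i) (i : ℕ) (s : ℤ) :
    down b (opX q a b f) i s = (q : ℂ) ^ s • down b (up a f) i s -
      ((q : ℂ) ^ (s - (i + 1)) * qInt q (s + 1) / (qInt q (i + 1 + 1) * qInt q (i + 1 + 2))) •
        down b (down b f) i (s + 1) := by
  simp [opX_apply]

theorem down_opY (f : ∀ i, ℤ → M i) (i : ℕ) (s : ℤ) :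
    down b (opY q a b f) i s = down b (up a f) i (s - 1) +
      (q * qInt q (i + 1 + 1 - s) / (qInt q (i + 1 + 1) * qInt q (i + 1 + 2))) •
        down b (down b f) i s := by
  simp [opY_apply]

end Ops

section Relations

variable {q : ℂˣ} {M : ℕ → Type u} [∀ i, AddCommGroup (M i)] [∀ i, Module ℂ (M i)]
  {a : ∀ i, M i →ₗ[ℂ] M (i + 1)} {b : ∀ i, M (i + 1) →ₗ[ℂ] M i}

theorem isQTriple : IsQTriple q (opE q M) (opF q M) (opK q M) (opK' q M) where
  K_Kinv f := by
    funext i s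
    rw [opK_apply, opK'_apply, smul_smul, ← zpow_add₀ q.ne_zero, add_neg_cancel, zpow_zero,
      one_smul]
  Kinv_K f := by
    funext i s
    rw [opK'_apply, opK_apply, smul_smul, ← zpow_add₀ q.ne_zero, neg_add_cancel, zpow_zero,
      one_smul]
  comm f := by
    funext i s
    have h := L.qInt_identity q s i
    simp only [Pi.sub_apply, Pi.smul_apply, opE_apply, opF_apply, opK_apply, opK'_apply,
      sub_add_cancel, add_sub_cancel_right, smul_smul, ← sub_smul]
    rw [← h]
    congr 1
    ring_nf
  K_E f := by
    funext i s
    simp only [Pi.smul_apply, opE_apply, opK_apply, smul_smul]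
    rw [mul_left_comm, ← zpow_add₀ q.ne_zero, mul_comm]
    ring_nf
  K_F f := by
    funext i s
    simp only [Pi.smul_apply, opF_apply, opK_apply, smul_smul]
    rw [mul_left_comm, ← zpow_add₀ q.ne_zero, mul_comm]
    ring_nf

theorem isSchrodinger (hq : ∀ n : ℕ, 0 < n → q ^ n ≠ 1) (h0 : b 0 ∘ₗ a 0 = 0)
    (h : ∀ i, a i ∘ₗ b i = b (i + 1) ∘ₗ a (i + 1)) :
    IsSchrodinger q (opE q M) (opF q M) (opK q M) (opK' q M) (opX q a b) (opY q a b) where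
  toIsQTriple := isQTriple
  K_X f := by
    funext i s
    have e1 : (q : ℂ) ^ ((i : ℤ) - 2 * s) = q * (q : ℂ) ^ ((i : ℤ) - 1 - 2 * s) := by
      rw [← zpow_one_add₀ q.ne_zero]; ring_nf
    have e2 : (q : ℂ) ^ ((i : ℤ) - 2 * s) = q * (q : ℂ) ^ ((i : ℤ) + 1 - 2 * (s + 1)) := by
      rw [← zpow_one_add₀ q.ne_zero]; ring_nf
    simp only [Pi.smul_apply, opX_apply, opK_apply, up_opK, down_apply, map_smul, smul_sub,
      Nat.cast_add, Nat.cast_one]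
    congr 1
    · rw [e1]; module
    · rw [e2]; module
  K_Y f := by
    funext i s
    have e1 : (q : ℂ) ^ ((i : ℤ) - 2 * s) =
        (q : ℂ)⁻¹ * (q : ℂ) ^ ((i : ℤ) - 1 - 2 * (s - 1)) := by
      rw [← zpow_neg_one, ← zpow_add₀ q.ne_zero]; ring_nf
    have e2 : (q : ℂ) ^ ((i : ℤ) - 2 * s) = (q : ℂ)⁻¹ * (q : ℂ) ^ ((i : ℤ) + 1 - 2 * s) := by
      rw [← zpow_neg_one, ← zpow_add₀ q.ne_zero]; ring_nf
    simp only [Pi.smul_apply, opY_apply, opK_apply, up_opK, down_apply, map_smul, smul_add,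
      Nat.cast_add, Nat.cast_one]
    congr 1
    · rw [e1]; module
    · rw [e2]; module
  E_X f := by
    funext i s
    have e1 : (q : ℂ) ^ (s + 1) = q * (q : ℂ) ^ s := by rw [zpow_add_one₀ q.ne_zero, mul_comm]
    have e2 : (q : ℂ) ^ (s + 1 - i) = q * (q : ℂ) ^ (s - i) := by
      rw [← zpow_one_add₀ q.ne_zero]; ring_nf
    simp only [Pi.smul_apply, opX_apply, opE_apply, up_opE, down_apply, map_smul, smul_sub]
    rw [e1, e2]
    module
  E_Y f := by
    funext i s
    simp only [Pi.smul_apply, Pi.add_apply, opX_apply, opY_apply, opE_apply, up_opE, down_apply,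
      map_smul, sub_add_cancel, add_sub_cancel_right]
    have e1 : qInt q (s + 1) = (q : ℂ) ^ s + (q : ℂ)⁻¹ * qInt q s := by
      rw [qInt_add_one' hq]; ring
    have e2 : q * qInt q ((i : ℤ) + 1 - (s + 1)) = qInt q (i + 1 - s) - (q : ℂ) ^ (s - i) := by
      have := qInt_add_one hq ((i : ℤ) - s)
      rw [show (i : ℤ) - s + 1 = i + 1 - s by ring, neg_sub] at this
      rw [this]; ring_nf
    have e3 : (q : ℂ)⁻¹ * (q * qInt q ((i : ℤ) + 1 - s)) = qInt q (i + 1 - s) := by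
      rw [inv_mul_cancel_left₀ q.ne_zero]
    simp only [div_eq_mul_inv]
    linear_combination (norm := module) e1 • up a f i s + (qInt q (s + 1) *
      (qInt q (i + 1) * qInt q (i + 2))⁻¹ * (e2 - e3)) • b i (f (i + 1) (s + 1))
  F_X f := by
    funext i s
    have h0 := q.ne_zero
    have hd : (q : ℂ) ^ 2 - 1 ≠ 0 := sq_sub_one_ne_zero hq
    have e1 : qInt q ((i : ℤ) - s + 1) * (q : ℂ) ^ (s - 1) =
        (q : ℂ) ^ (-((i : ℤ) - 1 - 2 * (s - 1))) + (q : ℂ) ^ s * qInt q ((i : ℤ) - 1 - s + 1) := by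
      simp only [qInt, zpow_add₀ h0, zpow_sub₀ h0, zpow_neg, two_mul, zpow_one, neg_sub]
      field_simp
      ring
    have e2 : - (qInt q ((i : ℤ) - s + 1) * ((q : ℂ) ^ (s - 1 - i) * qInt q s)) =
        q * qInt q (i + 1 - s) * (q : ℂ) ^ (-((i : ℤ) + 1 - 2 * s)) -
          (q : ℂ) ^ (s - i) * qInt q (s + 1) * qInt q ((i : ℤ) + 1 - (s + 1) + 1) := by
      simp only [qInt, zpow_add₀ h0, zpow_sub₀ h0, zpow_neg, two_mul, zpow_one]
      field_simp
      ring
    simp only [Pi.add_apply, opX_apply, opY_apply, opF_apply, opK'_apply, up_opK',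
      up_opF, down_apply, map_smul, sub_add_cancel, add_sub_cancel_right, Nat.cast_add,
      Nat.cast_one]
    simp only [div_eq_mul_inv]
    linear_combination (norm := module) e1 • up a f i (s - 1) +
      ((qInt q (i + 1) * qInt q (i + 2))⁻¹ * e2) • b i (f (i + 1) s)
  F_Y f := by
    funext i s
    have e1 : qInt q ((i : ℤ) - s + 1) = qInt q ((i : ℤ) - 1 - (s - 1) + 1) := by
      ring_nf
    have e2 : qInt q ((i : ℤ) - s + 1) * qInt q ((i : ℤ) + 1 - (s - 1)) =
        qInt q ((i : ℤ) + 1 - s) * qInt q ((i : ℤ) + 1 - s + 1) := by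
      ring_nf
    simp only [opY_apply, opF_apply,
      up_opF, down_apply, map_smul, Nat.cast_add, Nat.cast_one]
    simp only [div_eq_mul_inv]
    linear_combination (norm := module) e1 • up a f i (s - 1 - 1) +
      (q * (qInt q (i + 1) * qInt q (i + 2))⁻¹ * e2) • b i (f (i + 1) (s - 1))
  X_Y f := by
    funext i s
    rw [Pi.smul_apply, Pi.smul_apply, opX_apply, opY_apply, up_opX, up_opY, down_opX, down_opY,
      down_up h0 h]
    have e1 : (q : ℂ) ^ s = q * (q : ℂ) ^ (s - 1) := by
      rw [← zpow_one_add₀ q.ne_zero]; ring_nf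
    have e2 : (q : ℂ) ^ (s - i) * qInt q (s + 1) * qInt q (i + 1 + 1 - (s + 1)) =
        q * (qInt q (i + 1 - s) * ((q : ℂ) ^ (s - (i + 1)) * qInt q (s + 1))) := by
      have : (q : ℂ) ^ (s - i) = q * (q : ℂ) ^ (s - (i + 1)) := by
        rw [← zpow_one_add₀ q.ne_zero]; ring_nf
      rw [this]; ring_nf
    -- for `i = 0` the coefficients contain a division by `[0]`, but `up` vanishes there
    have e3 : ((q : ℂ) ^ s *
          (q * qInt q (i - 1 + 1 - s) / (qInt q (i - 1 + 1) * qInt q (i - 1 + 2))) -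
        (q : ℂ) ^ (s - i) * qInt q (s + 1) / (qInt q (i + 1) * qInt q (i + 2))) •
        up a (down b f) i s =
      (q * (q * qInt q (i + 1 - s) / (qInt q (i + 1) * qInt q (i + 2)) * (q : ℂ) ^ s -
        ((q : ℂ) ^ (s - 1 - (i - 1)) * qInt q (s - 1 + 1) /
          (qInt q (i - 1 + 1) * qInt q (i - 1 + 2))))) • up a (down b f) i s := by
      cases i with
      | zero => simp
      | succ i =>
        congr 1
        have h1 : qInt q ((i : ℤ) + 1) ≠ 0 := qInt_ne_zero hq (by omega)
        have h2 : qInt q ((i : ℤ) + 1 + 1) ≠ 0 := qInt_ne_zero hq (by omega)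
        have h3 : qInt q ((i : ℤ) + 1 + 2) ≠ 0 := qInt_ne_zero hq (by omega)
        have h0 := q.ne_zero
        have hd : (q : ℂ) ^ 2 - 1 ≠ 0 := sq_sub_one_ne_zero hq
        have e4 : (i : ℤ) + 2 = i + 1 + 1 := by ring
        push_cast
        simp only [sub_add_cancel, add_sub_cancel_right, e4]
        field_simp
        simp only [qInt, zpow_add₀ h0, zpow_sub₀ h0, zpow_neg, zpow_one]
        field_simp
        ring
    simp only [sub_add_cancel, add_sub_cancel_right] at e3 ⊢
    linear_combination (norm := module) e3 + e1 • up a (up a f) i (s - 1) -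
      (q * (qInt q (i + 1) * qInt q (i + 2))⁻¹ * (qInt q (i + 1 + 1) * qInt q (i + 1 + 2))⁻¹ * e2) •
        down b (down b f) i (s + 1)

end Relations

end Model

/-! ### The module attached to a representation of the quiver -/

namespace IsSchrodinger

variable {q : ℂˣ} {V : Type*} [AddCommGroup V] [Module ℂ V] {E F K K' X Y : Module.End ℂ V}

/-- The relations pass to invariant subspaces. -/
theorem restrict (h : IsSchrodinger q E F K K' X Y) {S : Submodule ℂ V}
    (hE : ∀ v ∈ S, E v ∈ S) (hF : ∀ v ∈ S, F v ∈ S) (hK : ∀ v ∈ S, K v ∈ S)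
    (hK' : ∀ v ∈ S, K' v ∈ S) (hX : ∀ v ∈ S, X v ∈ S) (hY : ∀ v ∈ S, Y v ∈ S) :
    IsSchrodinger q (E.restrict hE) (F.restrict hF) (K.restrict hK) (K'.restrict hK')
      (X.restrict hX) (Y.restrict hY) where
  K_Kinv v := Subtype.ext (h.K_Kinv v)
  Kinv_K v := Subtype.ext (h.Kinv_K v)
  comm v := Subtype.ext (h.comm v)
  K_E v := Subtype.ext (h.K_E v)
  K_F v := Subtype.ext (h.K_F v)
  K_X v := Subtype.ext (h.K_X v)
  K_Y v := Subtype.ext (h.K_Y v)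
  E_X v := Subtype.ext (h.E_X v)
  E_Y v := Subtype.ext (h.E_Y v)
  F_X v := Subtype.ext (h.F_X v)
  F_Y v := Subtype.ext (h.F_Y v)
  X_Y v := Subtype.ext (h.X_Y v)

end IsSchrodinger

namespace Model

section Support

variable (M : ℕ → Type u) [∀ i, AddCommGroup (M i)] [∀ i, Module ℂ (M i)]

/-- The families supported on `0 ≤ s ≤ i`. They form `⨁ i, L(i) ⊗ M i`. -/
def supported : Submodule ℂ (∀ i, ℤ → M i) where
  carrier := {f | ∀ (i : ℕ) (s : ℤ), s < 0 ∨ i < s → f i s = 0}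
  add_mem' hf hg i s h := by rw [Pi.add_apply, Pi.add_apply, hf i s h, hg i s h, add_zero]
  zero_mem' _ _ _ := rfl
  smul_mem' c f hf i s h := by rw [Pi.smul_apply, Pi.smul_apply, hf i s h, smul_zero]

variable {M} {q : ℂˣ} {a : ∀ i, M i →ₗ[ℂ] M (i + 1)} {b : ∀ i, M (i + 1) →ₗ[ℂ] M i}

theorem opE_mem : ∀ f ∈ supported M, opE q M f ∈ supported M := by
  intro f hf i s h
  rw [opE_apply]
  by_cases hs : s = -1
  · simp [hs]
  · rw [hf i (s + 1) (by omega), smul_zero]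

theorem opF_mem : ∀ f ∈ supported M, opF q M f ∈ supported M := by
  intro f hf i s h
  rw [opF_apply]
  by_cases hs : s = i + 1
  · simp [hs]
  · rw [hf i (s - 1) (by omega), smul_zero]

theorem opK_mem : ∀ f ∈ supported M, opK q M f ∈ supported M := by
  intro f hf i s h
  rw [opK_apply, hf i s h, smul_zero]

theorem opK'_mem : ∀ f ∈ supported M, opK' q M f ∈ supported M := by
  intro f hf i s h
  rw [opK'_apply, hf i s h, smul_zero]

theorem up_eq_zero {f : ∀ i, ℤ → M i} (hf : f ∈ supported M) {i : ℕ} {s : ℤ}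
    (h : s < 0 ∨ i ≤ s) : up a f i s = 0 := by
  cases i with
  | zero => rfl
  | succ i => rw [up_succ, hf i s (by omega), map_zero]

theorem opX_mem : ∀ f ∈ supported M, opX q a b f ∈ supported M := by
  intro f hf i s h
  rw [opX_apply, up_eq_zero hf (by omega)]
  by_cases hs : s = -1
  · simp [hs]
  · rw [down_apply, hf (i + 1) (s + 1) (by omega)]; simp

theorem opY_mem : ∀ f ∈ supported M, opY q a b f ∈ supported M := by
  intro f hf i s h
  rw [opY_apply, up_eq_zero hf (by omega)]
  by_cases hs : s = i + 1
  · simp [hs]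
  · rw [down_apply, hf (i + 1) s (by omega)]; simp

variable (q M)

/-- The action of `E` on `⨁ i, L(i) ⊗ M i`. -/
def actE : Module.End ℂ (supported M) := (opE q M).restrict opE_mem

/-- The action of `F` on `⨁ i, L(i) ⊗ M i`. -/
def actF : Module.End ℂ (supported M) := (opF q M).restrict opF_mem

/-- The action of `K` on `⨁ i, L(i) ⊗ M i`. -/
def actK : Module.End ℂ (supported M) := (opK q M).restrict opK_mem

/-- The action of `K⁻¹` on `⨁ i, L(i) ⊗ M i`. -/
def actK' : Module.End ℂ (supported M) := (opK' q M).restrict opK'_mem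

variable {M} (a b)

/-- The action of `X` on `⨁ i, L(i) ⊗ M i`. -/
def actX : Module.End ℂ (supported M) := (opX q a b).restrict opX_mem

/-- The action of `Y` on `⨁ i, L(i) ⊗ M i`. -/
def actY : Module.End ℂ (supported M) := (opY q a b).restrict opY_mem

variable {q a b}

theorem isSchrodinger_act (hq : ∀ n : ℕ, 0 < n → q ^ n ≠ 1) (h0 : b 0 ∘ₗ a 0 = 0)
    (h : ∀ i, a i ∘ₗ b i = b (i + 1) ∘ₗ a (i + 1)) :
    IsSchrodinger q (actE M q) (actF M q) (actK M q) (actK' M q) (actX q a b) (actY q a b) :=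
  (isSchrodinger hq h0 h).restrict _ _ _ _ _ _

variable (M)

theorem finite_supported [∀ i, Module.Finite ℂ (M i)] {B : ℕ}
    (hB : ∀ i, B ≤ i → Subsingleton (M i)) : Module.Finite ℂ (supported M) := by
  let φ : supported M →ₗ[ℂ] ∀ (i : Fin B) (_ : Fin (i + 1)), M i :=
    { toFun := fun f i s => f.1 i ((s : ℕ) : ℤ)
      map_add' := fun f g => rfl
      map_smul' := fun c f => rfl }
  refine Module.Finite.of_injective φ fun f g hfg =>
    Subtype.ext (funext fun i => funext fun s => ?_)
  by_cases hi : B ≤ i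
  · have := hB i hi
    exact Subsingleton.elim _ _
  · by_cases hs : s < 0 ∨ i < s
    · rw [f.2 i s hs, g.2 i s hs]
    · lift s to ℕ using by omega
      exact congrFun (congrFun hfg ⟨i, by omega⟩) ⟨s, by simp at hs ⊢; omega⟩

/-- The module `⨁ i, L(i) ⊗ M i` is of type `1`; boundedness of `M` makes the decomposition of a
vector into its weight components finite. -/
theorem iSup_wt_actK {B : ℕ} (hB : ∀ i, B ≤ i → Subsingleton (M i)) :
    ⨆ n : ℤ, wt q (actK M q) n = ⊤ := by
  classical
  rw [eq_top_iff]
  intro f _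
  -- the component of `f` of weight `n`
  let c : ℤ → supported M := fun n =>
    ⟨fun i s => if (i : ℤ) - 2 * s = n then f.1 i s else 0, fun i s h => by
      simp only [f.2 i s h, ite_self]⟩
  have hc : ∀ n, c n ∈ wt q (actK M q) n := by
    intro n
    rw [mem_wt]
    refine Subtype.ext (funext fun i => funext fun s => ?_)
    change opK q M (c n).1 i s = (q : ℂ) ^ n • (c n).1 i s
    rw [opK_apply]
    simp only [c]
    split_ifs with h
    · rw [h]
    · simp
  have hf : f = ∑ n ∈ Finset.Icc (-(B : ℤ)) B, c n := by
    refine Subtype.ext (funext fun i => funext fun s => ?_)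
    rw [Submodule.coe_sum, Finset.sum_apply, Finset.sum_apply]
    simp only [c, Finset.sum_ite_eq, Finset.mem_Icc]
    split_ifs with h
    · rfl
    · by_cases hi : B ≤ i
      · have := hB i hi
        exact Subsingleton.elim _ _
      · exact f.2 i s (by omega)
  rw [hf]
  exact Submodule.sum_mem _ fun n _ => Submodule.mem_iSup_of_mem n (hc n)

variable {M}

/-- The vector `u_{i,0} ⊗ m`. -/
def single (i : ℕ) (m : M i) : supported M :=
  ⟨Pi.single i (Pi.single 0 m), fun j s h => by
    by_cases hj : j = i
    · subst hj
      rw [Pi.single_eq_same, Pi.single_eq_of_ne (by omega)]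
    · rw [Pi.single_eq_of_ne hj]; rfl⟩

theorem single_same (i : ℕ) (m : M i) : (single i m).1 i 0 = m := by simp [single]

theorem single_of_ne {i : ℕ} (m : M i) {s : ℤ} (hs : s ≠ 0) (j : ℕ) : (single i m).1 j s = 0 := by
  by_cases hj : j = i
  · subst hj
    simp [single, hs]
  · simp [single, hj]

theorem single_of_ne' {i : ℕ} (m : M i) {j : ℕ} (hj : j ≠ i) (s : ℤ) : (single i m).1 j s = 0 := by
  simp [single, hj]

theorem single_mem_hwt (i : ℕ) (m : M i) : single i m ∈ hwt q (actE M q) (actK M q) i := by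
  rw [mem_hwt]
  constructor
  · refine Subtype.ext (funext fun j => funext fun s => ?_)
    change opK q M (single i m).1 j s = (q : ℂ) ^ (i : ℤ) • (single i m).1 j s
    rw [opK_apply]
    by_cases hs : s = 0
    · by_cases hj : j = i
      · subst hs hj; simp
      · rw [single_of_ne' m hj, smul_zero, smul_zero]
    · rw [single_of_ne m hs, smul_zero, smul_zero]
  · refine Subtype.ext (funext fun j => funext fun s => ?_)
    change opE q M (single i m).1 j s = 0
    rw [opE_apply]
    by_cases hs : s + 1 = 0
    · rw [hs, qInt_zero, zero_smul]
    · rw [single_of_ne m hs, smul_zero]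

theorem eq_single_of_mem_hwt (hq : ∀ n : ℕ, 0 < n → q ^ n ≠ 1) {i : ℕ} {f : supported M}
    (hf : f ∈ hwt q (actE M q) (actK M q) i) : f = single i (f.1 i 0) := by
  rw [mem_hwt] at hf
  refine Subtype.ext (funext fun j => funext fun s => ?_)
  by_cases hs : s = 0
  · subst hs
    by_cases hj : j = i
    · subst hj; rw [single_same]
    · rw [single_of_ne' _ hj]
      have h1 : opK q M f.1 j 0 = (q : ℂ) ^ (i : ℤ) • f.1 j 0 :=
        congrFun (congrFun (congrArg Subtype.val hf.1) j) 0
      rw [opK_apply, ← sub_eq_zero, ← sub_smul, smul_eq_zero, sub_eq_zero] at h1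
      refine h1.resolve_left fun h => hj ?_
      have := zpow_injective_of_not_root hq h
      omega
  · rw [single_of_ne _ hs]
    have h1 : opE q M f.1 j (s - 1) = 0 := congrFun (congrFun (congrArg Subtype.val hf.2) j) (s - 1)
    rw [opE_apply, sub_add_cancel, smul_eq_zero] at h1
    exact h1.resolve_left (qInt_ne_zero hq hs)

variable (M) in
/-- The highest weight vectors of weight `i` in `⨁ j, L(j) ⊗ M j` are the vectors `u_{i,0} ⊗ m`. -/
def hwtEquiv (hq : ∀ n : ℕ, 0 < n → q ^ n ≠ 1) (i : ℕ) :
    hwt q (actE M q) (actK M q) i ≃ₗ[ℂ] M i where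
  toFun f := f.1.1 i 0
  map_add' _ _ := rfl
  map_smul' _ _ := rfl
  invFun m := ⟨single i m, single_mem_hwt i m⟩
  left_inv f := Subtype.ext (eq_single_of_mem_hwt hq f.2).symm
  right_inv m := single_same i m

/-- On highest weight vectors `X` acts as the map `a_i`. -/
theorem actX_apply_zero {i : ℕ} {f : supported M} (hf : f ∈ hwt q (actE M q) (actK M q) i)
    (hq : ∀ n : ℕ, 0 < n → q ^ n ≠ 1) :
    (actX q a b f).1 (i + 1) 0 = a i (f.1 i 0) := by
  change opX q a b f.1 (i + 1) 0 = _
  rw [opX_apply, down_apply, eq_single_of_mem_hwt hq hf, single_of_ne _ (by omega)]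
  simp

/-- On highest weight vectors `[i + 1] Y - q⁻¹ X F` acts as the map `b_i`. -/
theorem actY_apply_zero (i : ℕ) (f : supported M) (hq : ∀ n : ℕ, 0 < n → q ^ n ≠ 1) :
    (qInt q (i + 1) • actY q a b f - (q : ℂ)⁻¹ • actX q a b (actF M q f)).1 i 0 =
      b i (f.1 (i + 1) 0) := by
  change qInt q (i + 1) • opY q a b f.1 i 0 - (q : ℂ)⁻¹ • opX q a b (opF q M f.1) i 0 = _
  have h1 : qInt q ((i : ℤ) + 1) ≠ 0 := qInt_ne_zero hq (by omega)
  have h2 : qInt q ((i : ℤ) + 2) ≠ 0 := qInt_ne_zero hq (by omega)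
  have h3 := qInt_add_one hq ((i : ℤ) + 1)
  have h4 : (q : ℂ) ^ (-((i : ℤ) + 1)) = (q : ℂ)⁻¹ * (q : ℂ) ^ (-(i : ℤ)) := by
    rw [neg_add, zpow_add₀ q.ne_zero, zpow_neg_one, mul_comm]
  have h5 : opF q M f.1 (i + 1) 1 = qInt q (i + 1) • f.1 (i + 1) 0 := by
    rw [opF_apply]; simp
  rw [opX_apply, opY_apply, up_opF, down_apply, down_apply, zero_add, h5, map_smul,
    up_eq_zero (a := a) f.2 (by omega), qInt_one hq]
  rw [show (i : ℤ) + 1 + 1 = i + 2 by ring, h4] at h3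
  have h6 : qInt q (i + 1) * (q * qInt q (i + 1 - 0) / (qInt q (i + 1) * qInt q (i + 2))) +
      (q : ℂ)⁻¹ * ((q : ℂ) ^ ((0 : ℤ) - i) * 1 / (qInt q (i + 1) * qInt q (i + 2)) *
        qInt q (i + 1)) = 1 := by
    rw [sub_zero, zero_sub]
    field_simp
    linear_combination (-(q : ℂ)) * h3 - (q : ℂ) ^ (-(i : ℤ)) * mul_inv_cancel₀ q.ne_zero
  linear_combination (norm := module) h6 • b i (f.1 (i + 1) 0)

end Support

end Model

/-! ### The quiver representation on highest weight vectors -/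

namespace IsSchrodinger

variable {q : ℂˣ} {V : Type u} [AddCommGroup V] [Module ℂ V] {E F K K' X Y : Module.End ℂ V}

theorem X_mem (h : IsSchrodinger q E F K K' X Y) {n : ℤ} {v : V} (hv : v ∈ wt q K n) :
    X v ∈ wt q K (n + 1) := by
  rw [mem_wt] at hv ⊢
  rw [h.K_X, hv, map_smul, smul_smul, ← zpow_one_add₀ q.ne_zero, add_comm]

theorem Y_mem (h : IsSchrodinger q E F K K' X Y) {n : ℤ} {v : V} (hv : v ∈ wt q K n) :
    Y v ∈ wt q K (n - 1) := by
  rw [mem_wt] at hv ⊢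
  rw [h.K_Y, hv, map_smul, smul_smul, ← zpow_neg_one, ← zpow_add₀ q.ne_zero, add_comm,
    sub_eq_add_neg]

theorem X_mem_hwt (h : IsSchrodinger q E F K K' X Y) {i : ℕ} {w : V} (hw : w ∈ hwt q E K i) :
    X w ∈ hwt q E K (i + 1 : ℕ) := by
  rw [mem_hwt]
  exact ⟨mem_wt.mp (by simpa using h.X_mem hw.1),
    by rw [h.E_X, (mem_hwt.mp hw).2, map_zero, smul_zero]⟩

/-- The operator `[i + 1] Y - q⁻¹ X F`. -/
def lower (q : ℂˣ) (F X Y : Module.End ℂ V) (i : ℕ) : Module.End ℂ V :=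
  qInt q (i + 1) • Y - (q : ℂ)⁻¹ • (X * F)

theorem lower_apply (i : ℕ) (w : V) :
    lower q F X Y i w = qInt q (i + 1) • Y w - (q : ℂ)⁻¹ • X (F w) := rfl

theorem lower_mem_hwt (h : IsSchrodinger q E F K K' X Y) {i : ℕ}
    {w : V} (hw : w ∈ hwt q E K (i + 1 : ℕ)) : lower q F X Y i w ∈ hwt q E K i := by
  have hEw := (mem_hwt.mp hw).2
  constructor
  · rw [lower_apply]
    have h1 := h.Y_mem hw.1
    have h2 := h.X_mem (h.F_mem hw.1)
    push_cast at h1 h2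
    rw [add_sub_cancel_right] at h1
    rw [show (i : ℤ) + 1 - 2 + 1 = i by ring] at h2
    exact sub_mem (Submodule.smul_mem _ _ h1) (Submodule.smul_mem _ _ h2)
  · refine LinearMap.mem_ker.mpr ?_
    rw [lower_apply, map_sub, map_smul, map_smul, h.E_Y, h.E_X, h.E_F hw.1, hEw, map_zero, map_zero,
      smul_zero, add_zero, zero_add, map_smul, inv_smul_smul₀ q.ne_zero]
    simp

/-- The map `a_i`, given by the action of `X`. -/
def hwUp (h : IsSchrodinger q E F K K' X Y) (i : ℕ) :
    hwt q E K i →ₗ[ℂ] hwt q E K (i + 1 : ℕ) :=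
  X.restrict fun _ hw => h.X_mem_hwt hw

/-- The map `b_i`, given by the action of `[i + 1] Y - q⁻¹ X F`. -/
def hwDown (h : IsSchrodinger q E F K K' X Y) (i : ℕ) :
    hwt q E K (i + 1 : ℕ) →ₗ[ℂ] hwt q E K i :=
  (lower q F X Y i).restrict fun _ hw => h.lower_mem_hwt hw

theorem coe_hwUp (h : IsSchrodinger q E F K K' X Y) (i : ℕ) (w : hwt q E K i) :
    (h.hwUp i w : V) = X w := rfl

theorem coe_hwDown (h : IsSchrodinger q E F K K' X Y) (i : ℕ) (w : hwt q E K (i + 1 : ℕ)) :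
    (h.hwDown i w : V) = qInt q (i + 1) • Y (w : V) - (q : ℂ)⁻¹ • X (F w) := rfl

/-- For a highest weight vector `w`, the relation between `F X` and `X F` reads
`F X w = q ^ (-n) Y w + X F w`. -/
theorem F_X_of_wt (h : IsSchrodinger q E F K K' X Y) {n : ℤ} {w : V} (hw : w ∈ wt q K n) :
    F (X w) = (q : ℂ) ^ (-n) • Y w + X (F w) := by
  rw [h.F_X, h.Kinv_of_wt hw, map_smul]

theorem Y_X (h : IsSchrodinger q E F K K' X Y) (v : V) : Y (X v) = (q : ℂ)⁻¹ • X (Y v) := by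
  rw [h.X_Y, inv_smul_smul₀ q.ne_zero]

theorem hwDown_hwUp_zero (hq : ∀ n : ℕ, 0 < n → q ^ n ≠ 1) [Module.Finite ℂ V]
    (h : IsSchrodinger q E F K K' X Y) : h.hwDown 0 ∘ₗ h.hwUp 0 = 0 := by
  refine LinearMap.ext fun w => Subtype.ext ?_
  have hF : F (w : V) = 0 := by simpa using h.F_pow_hwt hq w.2
  change qInt q ((0 : ℕ) + 1) • Y (X (w : V)) - (q : ℂ)⁻¹ • X (F (X w)) = 0
  rw [h.F_X_of_wt w.2.1, hF, h.Y_X]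
  simp [qInt_one hq]

theorem hwUp_hwDown (hq : ∀ n : ℕ, 0 < n → q ^ n ≠ 1)
    (h : IsSchrodinger q E F K K' X Y) (i : ℕ) :
    h.hwUp i ∘ₗ h.hwDown i = h.hwDown (i + 1) ∘ₗ h.hwUp (i + 1) := by
  refine LinearMap.ext fun w => Subtype.ext ?_
  change X (qInt q (i + 1) • Y (w : V) - (q : ℂ)⁻¹ • X (F w)) =
    qInt q ((i + 1 : ℕ) + 1) • Y (X (w : V)) - (q : ℂ)⁻¹ • X (F (X w))
  have h1 := qInt_add_one hq ((i : ℤ) + 1)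
  have h2 : (q : ℂ)⁻¹ * qInt q ((i : ℤ) + 1 + 1) - (q : ℂ)⁻¹ * (q : ℂ) ^ (-((i : ℤ) + 1)) =
      qInt q ((i : ℤ) + 1) := by
    rw [h1, mul_add, inv_mul_cancel_left₀ q.ne_zero, add_sub_cancel_right]
  rw [h.F_X_of_wt w.2.1, h.Y_X]
  push_cast
  simp only [map_sub, map_add, map_smul]
  linear_combination (norm := module) -h2 • X (Y (w : V))

theorem E_pow_X (h : IsSchrodinger q E F K K' X Y) (s : ℕ) (v : V) :
    (E ^ s) (X v) = (q : ℂ) ^ s • X ((E ^ s) v) := by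
  induction s with
  | zero => simp
  | succ s ih =>
    rw [pow_succ', Module.End.mul_apply, ih, map_smul, h.E_X, smul_smul, Module.End.mul_apply,
      pow_succ]

theorem E_pow_Y (hq : ∀ n : ℕ, 0 < n → q ^ n ≠ 1) (h : IsSchrodinger q E F K K' X Y) (s : ℕ)
    (v : V) :
    (E ^ (s + 1)) (Y v) =
      (q : ℂ) ^ (-((s : ℤ) + 1)) • Y ((E ^ (s + 1)) v) + qInt q (s + 1) • X ((E ^ s) v) := by
  induction s with
  | zero =>
    simp [h.E_Y, qInt_one hq, add_comm]
  | succ s ih =>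
    have e1 : (q : ℂ) ^ (-((s : ℤ) + 1 + 1)) = (q : ℂ) ^ (-((s : ℤ) + 1)) * (q : ℂ)⁻¹ := by
      rw [neg_add, zpow_add₀ q.ne_zero, zpow_neg_one]
    have e2 := qInt_add_one hq ((s : ℤ) + 1)
    rw [pow_succ', Module.End.mul_apply, ih, map_add, map_smul, map_smul, h.E_Y, h.E_X,
      Module.End.mul_apply, pow_succ' E s, Module.End.mul_apply]
    push_cast
    rw [e1, e2]
    module

section proj

variable (hq : ∀ n : ℕ, 0 < n → q ^ n ≠ 1) [Module.Finite ℂ V]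
  (h : IsSchrodinger q E F K K' X Y) (htop : ⨆ n : ℤ, wt q K n = ⊤)

/-- Only the component of weight `i + 1` of `v` matters. It is `w + F y` with `w` of highest weight;
the term `Y F y = F Y y` is killed, and `Y w = (q b w + F a w) / [i + 2]`. -/
theorem proj_Y (i : ℕ) (v : V) :
    h.proj hq htop i (Y v) = ((q : ℂ) / qInt q (i + 2)) • h.hwDown i (h.proj hq htop (i + 1) v) := by
  refine ext_of_wt htop (f := h.proj hq htop i ∘ₗ Y)
    (g := ((q : ℂ) / qInt q (i + 2)) • h.hwDown i ∘ₗ h.proj hq htop (i + 1)) (fun n v hv => ?_) v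
  simp only [LinearMap.comp_apply, LinearMap.smul_apply]
  by_cases hn : n = (i + 1 : ℕ)
  · subst hn
    obtain ⟨w, hw, y, hy, rfl⟩ := h.exists_eq_add_F hq (by omega) hv
    have h1 : h.proj hq htop (i + 1) w = ⟨w, hw⟩ := h.proj_hwt hq htop (i + 1) ⟨w, hw⟩
    rw [map_add, map_add, map_add, ← h.F_Y, h.proj_F, h.proj_F, add_zero, add_zero, h1]
    have h2 : Y w = ((q : ℂ) / qInt q (i + 2)) • (h.hwDown i ⟨w, hw⟩ : V) +
        (qInt q (i + 2))⁻¹ • F (X w) := by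
      have h3 : qInt q ((i : ℤ) + 2) ≠ 0 := qInt_ne_zero hq (by omega)
      have h4 := qInt_add_one hq ((i : ℤ) + 1)
      rw [show (i : ℤ) + 1 + 1 = i + 2 by ring] at h4
      rw [coe_hwDown, h.F_X_of_wt hw.1, div_eq_inv_mul, mul_smul, ← smul_add, eq_inv_smul_iff₀ h3,
        smul_sub, smul_inv_smul₀ q.ne_zero]
      push_cast
      linear_combination (norm := module) h4 • Y w
    rw [h2, map_add, map_smul, map_smul, h.proj_F, smul_zero, add_zero, h.proj_hwt]
  · rw [h.proj_of_ne hq htop (i + 1) hn hv, map_zero, smul_zero]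
    exact h.proj_of_ne hq htop i (n := n - 1) (by push_cast at hn; omega) (h.Y_mem hv)

/-- The contribution of the image of `F` to the projections of `X v`: in
`X F y = F X y - q ^ (-(i + 1)) Y y` the first term is killed, and `E F y = F E y + [i + 1] y`. -/
theorem proj_X_F (i : ℕ) (y : V) (hy : y ∈ wt q K (i + 1)) :
    h.proj hq htop i (X (F y)) = -((q : ℂ) ^ (-(i : ℤ)) / (qInt q (i + 1) * qInt q (i + 2))) •
      h.hwDown i (h.proj hq htop (i + 1) (E (F y))) := by
  have h1 : X (F y) = F (X y) - (q : ℂ) ^ (-((i : ℤ) + 1)) • Y y := by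
    rw [h.F_X_of_wt hy, add_sub_cancel_left]
  have h3 : qInt q ((i : ℤ) + 1) ≠ 0 := qInt_ne_zero hq (by omega)
  rw [h1, map_sub, h.proj_F, map_smul, zero_sub, h.proj_Y hq htop, h.E_F hy, map_add, h.proj_F,
    zero_add, map_smul, map_smul, smul_smul, smul_smul, ← neg_smul]
  congr 1
  rw [neg_add, zpow_add₀ q.ne_zero, zpow_neg_one]
  have := q.ne_zero
  field_simp

theorem proj_X_zero (v : V) :
    h.proj hq htop 0 (X v) =
      -((q : ℂ) ^ (-((0 : ℕ) : ℤ)) / (qInt q ((0 : ℕ) + 1) * qInt q ((0 : ℕ) + 2))) •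
      h.hwDown 0 (h.proj hq htop 1 (E v)) := by
  refine ext_of_wt htop (f := h.proj hq htop 0 ∘ₗ X)
    (g := -((q : ℂ) ^ (-((0 : ℕ) : ℤ)) / (qInt q ((0 : ℕ) + 1) * qInt q ((0 : ℕ) + 2))) •
      h.hwDown 0 ∘ₗ h.proj hq htop 1 ∘ₗ E) (fun n v hv => ?_) v
  simp only [LinearMap.comp_apply, LinearMap.smul_apply]
  by_cases hn : n = -1
  · subst hn
    obtain ⟨y, hy, rfl⟩ := h.exists_eq_F hq (by omega) hv
    exact h.proj_X_F hq htop 0 y (by simpa using hy)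
  · rw [h.proj_of_ne hq htop 1 (n := n + 2) (by push_cast; omega) (h.E_mem hv), map_zero, smul_zero]
    exact h.proj_of_ne hq htop 0 (n := n + 1) (by push_cast; omega) (h.X_mem hv)

theorem proj_X_succ (i : ℕ) (v : V) :
    h.proj hq htop (i + 1) (X v) = h.hwUp i (h.proj hq htop i v) -
      ((q : ℂ) ^ (-((i + 1 : ℕ) : ℤ)) / (qInt q ((i + 1 : ℕ) + 1) * qInt q ((i + 1 : ℕ) + 2))) •
      h.hwDown (i + 1) (h.proj hq htop (i + 2) (E v)) := by
  refine ext_of_wt htop (f := h.proj hq htop (i + 1) ∘ₗ X)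
    (g := h.hwUp i ∘ₗ h.proj hq htop i -
      ((q : ℂ) ^ (-((i + 1 : ℕ) : ℤ)) / (qInt q ((i + 1 : ℕ) + 1) * qInt q ((i + 1 : ℕ) + 2))) •
      h.hwDown (i + 1) ∘ₗ h.proj hq htop (i + 2) ∘ₗ E) (fun n v hv => ?_) v
  simp only [LinearMap.comp_apply, LinearMap.smul_apply, LinearMap.sub_apply]
  by_cases hn : n = i
  · subst hn
    obtain ⟨w, hw, y, hy, rfl⟩ := h.exists_eq_add_F hq (by omega) hv
    have h1 : h.proj hq htop i w = ⟨w, hw⟩ := h.proj_hwt hq htop i ⟨w, hw⟩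
    have h2 : h.proj hq htop (i + 1) (X w) = h.hwUp i ⟨w, hw⟩ :=
      h.proj_hwt hq htop (i + 1) (h.hwUp i ⟨w, hw⟩)
    have h3 := h.proj_X_F hq htop (i + 1) y (by push_cast; rwa [add_assoc])
    rw [map_add, map_add, map_add, map_add, map_add, h.proj_F, (mem_hwt.mp hw).2, h1, h2, map_zero,
      add_zero, zero_add, h3, neg_smul, sub_eq_add_neg]
  · rw [h.proj_of_ne hq htop (i + 2) (n := n + 2) (by push_cast; omega) (h.E_mem hv),
      h.proj_of_ne hq htop i hn hv, map_zero, map_zero, smul_zero, sub_zero]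
    exact h.proj_of_ne hq htop (i + 1) (n := n + 1) (by push_cast; omega) (h.X_mem hv)

end proj

end IsSchrodinger

/-! ### Comparison of a module with the module of its highest weight vectors -/

section Coord

variable {q : ℂˣ} {V : Type u} [AddCommGroup V] [Module ℂ V] {E F K K' X Y : Module.End ℂ V}
  (hq : ∀ n : ℕ, 0 < n → q ^ n ≠ 1) [Module.Finite ℂ V]

theorem exists_hwt_bound {q : ℂˣ} (hq : ∀ n : ℕ, 0 < n → q ^ n ≠ 1) (E K : Module.End ℂ V) :
    ∃ B : ℕ, ∀ i : ℕ, B ≤ i → Subsingleton (hwt q E K i) := by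
  obtain ⟨B, hB⟩ := exists_wt_bound hq K
  refine ⟨B + 1, fun i hi => ?_⟩
  have h1 : hwt q E K i = ⊥ := by
    rw [hwt, hB i (by omega), bot_inf_eq]
  rw [h1]
  infer_instance

namespace IsQTriple

variable (h : IsQTriple q E F K K') (htop : ⨆ n : ℤ, wt q K n = ⊤)

theorem proj_E_pow_F (i s : ℕ) (v : V) :
    h.proj hq htop i ((E ^ (s + 1)) (F v)) =
      (qInt q (s + 1) * qInt q (i - s)) • h.proj hq htop i ((E ^ s) v) := by
  refine ext_of_wt htop (f := h.proj hq htop i ∘ₗ (E ^ (s + 1)) ∘ₗ F)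
    (g := (qInt q (s + 1) * qInt q (i - s)) • h.proj hq htop i ∘ₗ (E ^ s)) (fun n v hv => ?_) v
  simp only [LinearMap.comp_apply, LinearMap.smul_apply]
  rw [h.E_pow_F hq s hv, map_add, h.proj_F, zero_add, map_smul]
  by_cases hn : n + 2 * s = i
  · rw [show n + (s : ℤ) = i - s by omega]
  · rw [h.proj_of_ne hq htop i hn (h.E_pow_mem hv s), smul_zero, smul_zero]

/-- The vectors `E ^ s v` with `s > i` have no component among the highest weight vectors of
weight `i`, because `v` would have to have negative weight and so would be in the image of `F`. -/
theorem proj_E_pow_eq_zero {i s : ℕ} (hs : i < s) (v : V) :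
    h.proj hq htop i ((E ^ s) v) = 0 := by
  induction s generalizing v with
  | zero => omega
  | succ s ih =>
    refine ext_of_wt htop (f := h.proj hq htop i ∘ₗ (E ^ (s + 1))) (g := 0) (fun n v hv => ?_) v
    simp only [LinearMap.comp_apply, LinearMap.zero_apply]
    by_cases hn : n + 2 * (s + 1 : ℕ) = i
    · obtain ⟨y, -, rfl⟩ := h.exists_eq_F hq (by omega) hv
      rw [h.proj_E_pow_F]
      rcases Nat.lt_or_ge i s with his | his
      · rw [ih his, smul_zero]
      · rw [show s = i by omega, sub_self, qInt_zero, mul_zero, zero_smul]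
    · exact h.proj_of_ne hq htop i hn (h.E_pow_mem hv (s + 1))

/-- The coefficient of `u_{i,s}` in a vector: `E ^ s u_{i,s} = [s]! v_i`, so it is the component of
`E ^ s v / [s]!` in the highest weight vectors of weight `i`. -/
def coord (i : ℕ) : ℤ → (V →ₗ[ℂ] hwt q E K i)
  | .ofNat s => (qFact q s)⁻¹ • (h.proj hq htop i ∘ₗ (E ^ s))
  | .negSucc _ => 0

theorem coord_natCast (i s : ℕ) (v : V) :
    h.coord hq htop i s v = (qFact q s)⁻¹ • h.proj hq htop i ((E ^ s) v) := rfl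

theorem coord_zero (i : ℕ) (v : V) : h.coord hq htop i 0 v = h.proj hq htop i v := by
  have := h.coord_natCast hq htop i 0 v
  simpa [qFact] using this

theorem coord_of_neg (i : ℕ) {s : ℤ} (hs : s < 0) (v : V) : h.coord hq htop i s v = 0 := by
  cases s with
  | ofNat s => exact absurd hs (by simp)
  | negSucc s => rfl

theorem coord_of_lt (i : ℕ) {s : ℤ} (hs : i < s) (v : V) : h.coord hq htop i s v = 0 := by
  lift s to ℕ using by omega
  rw [coord_natCast, h.proj_E_pow_eq_zero hq htop (by omega), smul_zero]

theorem coord_E (i : ℕ) (s : ℤ) (v : V) :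
    h.coord hq htop i s (E v) = qInt q (s + 1) • h.coord hq htop i (s + 1) v := by
  rcases lt_trichotomy s (-1) with hs | rfl | hs
  · rw [h.coord_of_neg hq htop i (by omega), h.coord_of_neg hq htop i (by omega), smul_zero]
  · rw [h.coord_of_neg hq htop i (by omega), neg_add_cancel, qInt_zero, zero_smul]
  · lift s to ℕ using by omega
    have h1 := h.coord_natCast hq htop i (s + 1) v
    push_cast at h1
    rw [h1, coord_natCast, smul_smul, qFact, mul_inv,
      mul_inv_cancel_left₀ (qInt_ne_zero hq (by omega)), pow_succ, Module.End.mul_apply]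

theorem coord_F (i : ℕ) (s : ℤ) (v : V) :
    h.coord hq htop i s (F v) = qInt q (i - s + 1) • h.coord hq htop i (s - 1) v := by
  rcases lt_trichotomy s 0 with hs | rfl | hs
  · rw [h.coord_of_neg hq htop i (by omega), h.coord_of_neg hq htop i (by omega), smul_zero]
  · rw [h.coord_of_neg hq htop i (s := 0 - 1) (by omega), smul_zero, coord_zero, proj_F]
  · obtain ⟨t, rfl⟩ : ∃ t : ℕ, s = (t + 1 : ℕ) := ⟨(s - 1).toNat, by omega⟩
    have h0 : qInt q ((t : ℤ) + 1) ≠ 0 := qInt_ne_zero hq (by omega)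
    rw [show ((t + 1 : ℕ) : ℤ) - 1 = t by omega, coord_natCast, coord_natCast, h.proj_E_pow_F,
      qFact, smul_smul, smul_smul, show (i : ℤ) - (t + 1 : ℕ) + 1 = i - t by push_cast; ring]
    congr 1
    field_simp

theorem coord_K (i : ℕ) (s : ℤ) (v : V) :
    h.coord hq htop i s (K v) = (q : ℂ) ^ ((i : ℤ) - 2 * s) • h.coord hq htop i s v := by
  rcases lt_or_ge s 0 with hs | hs
  · rw [h.coord_of_neg hq htop i hs, h.coord_of_neg hq htop i hs, smul_zero]
  · lift s to ℕ using hs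
    refine ext_of_wt htop (f := h.coord hq htop i s ∘ₗ K)
      (g := (q : ℂ) ^ ((i : ℤ) - 2 * s) • h.coord hq htop i s) (fun n v hv => ?_) v
    simp only [LinearMap.comp_apply, LinearMap.smul_apply]
    rw [mem_wt.mp hv, map_smul, coord_natCast]
    by_cases hn : n + 2 * s = i
    · rw [show (i : ℤ) - 2 * s = n by omega]
    · rw [h.proj_of_ne hq htop i hn (h.E_pow_mem hv s), smul_zero, smul_zero, smul_zero]

theorem coord_Kinv (i : ℕ) (s : ℤ) (v : V) :
    h.coord hq htop i s (K' v) = (q : ℂ) ^ (-((i : ℤ) - 2 * s)) • h.coord hq htop i s v := by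
  have h1 := h.coord_K hq htop i s (K' v)
  rw [h.K_Kinv] at h1
  rw [h1, smul_smul, ← zpow_add₀ q.ne_zero, neg_add_cancel, zpow_zero, one_smul]

end IsQTriple

namespace IsSchrodinger

variable (h : IsSchrodinger q E F K K' X Y) (htop : ⨆ n : ℤ, wt q K n = ⊤)

/-- The family of coefficients of a vector, as an element of `⨁ i, L(i) ⊗ V_i`. -/
def delta : V →ₗ[ℂ] Model.supported (fun i : ℕ => hwt q E K i) where
  toFun v := ⟨fun i s => h.coord hq htop i s v, fun i _ hs =>
    hs.elim (fun hs => h.coord_of_neg hq htop i hs v) (fun hs => h.coord_of_lt hq htop i hs v)⟩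
  map_add' v w := Subtype.ext (funext fun _ => funext fun _ => map_add _ v w)
  map_smul' c v := Subtype.ext (funext fun _ => funext fun _ => map_smul _ c v)

theorem delta_apply (v : V) (i : ℕ) (s : ℤ) :
    (h.delta hq htop v).1 i s = h.coord hq htop i s v := rfl

theorem delta_E (v : V) : h.delta hq htop (E v) = Model.actE _ q (h.delta hq htop v) :=
  Subtype.ext (funext fun i => funext fun s => h.coord_E hq htop i s v)

theorem delta_F (v : V) : h.delta hq htop (F v) = Model.actF _ q (h.delta hq htop v) :=
  Subtype.ext (funext fun i => funext fun s => h.coord_F hq htop i s v)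

theorem delta_K (v : V) : h.delta hq htop (K v) = Model.actK _ q (h.delta hq htop v) :=
  Subtype.ext (funext fun i => funext fun s =>
    (h.coord_K hq htop i s v).trans (Model.opK_apply q (h.delta hq htop v).1 i s).symm)

theorem delta_Kinv (v : V) : h.delta hq htop (K' v) = Model.actK' _ q (h.delta hq htop v) :=
  Subtype.ext (funext fun i => funext fun s =>
    (h.coord_Kinv hq htop i s v).trans (Model.opK'_apply q (h.delta hq htop v).1 i s).symm)

/-- The projections of `X v`, uniformly in `i`. -/
theorem proj_X (i : ℕ) (v : V) :
    h.proj hq htop i (X v) =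
      Model.up h.hwUp (fun j _ => h.proj hq htop j v) i 0 -
      ((q : ℂ) ^ (-(i : ℤ)) / (qInt q (i + 1) * qInt q (i + 2))) •
        h.hwDown i (h.proj hq htop (i + 1) (E v)) := by
  cases i with
  | zero => rw [Model.up_zero, zero_sub, ← neg_smul]; exact h.proj_X_zero hq htop v
  | succ i => exact h.proj_X_succ hq htop i v

theorem up_coord (i s : ℕ) (v : V) :
    Model.up h.hwUp (fun j t => h.coord hq htop j t v) i s =
      (qFact q s)⁻¹ • Model.up h.hwUp (fun j _ => h.proj hq htop j ((E ^ s) v)) i 0 := by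
  cases i with
  | zero => simp
  | succ i => rw [Model.up_succ, Model.up_succ, h.coord_natCast, map_smul]

theorem delta_X (v : V) :
    h.delta hq htop (X v) = Model.actX q h.hwUp h.hwDown (h.delta hq htop v) := by
  refine Subtype.ext (funext fun i => funext fun s => ?_)
  rcases lt_or_ge s 0 with hs | hs
  · rw [(h.delta hq htop (X v)).2 i s (Or.inl hs),
      (Model.actX q h.hwUp h.hwDown (h.delta hq htop v)).2 i s (Or.inl hs)]
  lift s to ℕ using hs
  change h.coord hq htop i s (X v) = Model.opX q h.hwUp h.hwDown (h.delta hq htop v).1 i s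
  rw [Model.opX_apply]
  change _ = _ • Model.up h.hwUp (fun j t => h.coord hq htop j t v) i s -
    _ • h.hwDown i (h.coord hq htop (i + 1) (s + 1 : ℕ) v)
  rw [up_coord, h.coord_natCast, h.coord_natCast, h.E_pow_X, map_smul, h.proj_X, qFact]
  rw [← Module.End.mul_apply, ← pow_succ']
  have e1 : (q : ℂ) ^ ((s : ℤ) - i) = (q : ℂ) ^ s * (q : ℂ) ^ (-(i : ℤ)) := by
    rw [sub_eq_add_neg, zpow_add₀ q.ne_zero, zpow_natCast]
  have h0 : qInt q ((s : ℤ) + 1) ≠ 0 := qInt_ne_zero hq (by omega)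
  have e2 : qInt q ((s : ℤ) + 1) * (qInt q ((s : ℤ) + 1))⁻¹ = 1 := mul_inv_cancel₀ h0
  rw [e1, zpow_natCast, map_smul]
  simp only [div_eq_mul_inv, mul_inv]
  linear_combination (norm := module) ((qFact q s)⁻¹ * (q : ℂ) ^ s * (q : ℂ) ^ (-(i : ℤ)) *
    (qInt q (i + 1))⁻¹ * (qInt q (i + 2))⁻¹ * e2) •
    h.hwDown i (h.proj hq htop (i + 1) ((E ^ (s + 1)) v))

theorem delta_Y (v : V) :
    h.delta hq htop (Y v) = Model.actY q h.hwUp h.hwDown (h.delta hq htop v) := by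
  refine Subtype.ext (funext fun i => funext fun s => ?_)
  rcases lt_or_ge s 0 with hs | hs
  · rw [(h.delta hq htop (Y v)).2 i s (Or.inl hs),
      (Model.actY q h.hwUp h.hwDown (h.delta hq htop v)).2 i s (Or.inl hs)]
  lift s to ℕ using hs
  change h.coord hq htop i s (Y v) = Model.opY q h.hwUp h.hwDown (h.delta hq htop v).1 i s
  have h1 : qInt q ((i : ℤ) + 1) ≠ 0 := qInt_ne_zero hq (by omega)
  rw [Model.opY_apply]
  change _ = Model.up h.hwUp (fun j t => h.coord hq htop j t v) i (s - 1) +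
    _ • h.hwDown i (h.coord hq htop (i + 1) s v)
  cases s with
  | zero =>
    have hup : Model.up h.hwUp (fun j t => h.coord hq htop j t v) i (((0 : ℕ) : ℤ) - 1) = 0 :=
      Model.up_eq_zero (h.delta hq htop v).2 (by left; simp)
    rw [hup, Nat.cast_zero, h.coord_zero,
      h.coord_zero, h.proj_Y, zero_add, sub_zero]
    congr 1
    field_simp
  | succ s =>
    rw [show ((s + 1 : ℕ) : ℤ) - 1 = s by omega, up_coord, h.coord_natCast, h.coord_natCast,
      h.E_pow_Y hq, map_add, map_smul, map_smul, h.proj_X, h.proj_Y, qFact, map_smul,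
      ← Module.End.mul_apply E, ← pow_succ']
    have h0 : qInt q ((s : ℤ) + 1) ≠ 0 := qInt_ne_zero hq (by omega)
    have e2 : qInt q ((s : ℤ) + 1) * (qInt q ((s : ℤ) + 1))⁻¹ = 1 := mul_inv_cancel₀ h0
    have e3 : (q : ℂ) ^ (-((s : ℤ) + 1)) * (q * qInt q (i + 1)) -
        qInt q (s + 1) * (q : ℂ) ^ (-(i : ℤ)) = q * qInt q (i + 1 - (s + 1 : ℕ)) := by
      have hd := sq_sub_one_ne_zero hq
      have h0 := q.ne_zero
      push_cast
      simp only [qInt, zpow_add₀ h0, zpow_sub₀ h0, zpow_neg, zpow_one]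
      field_simp
      ring
    have e4 : (q : ℂ) / qInt q (i + 2) =
        q * qInt q (i + 1) * ((qInt q (i + 1))⁻¹ * (qInt q (i + 2))⁻¹) := by
      field_simp
    rw [e4]
    simp only [div_eq_mul_inv, mul_inv]
    linear_combination (norm := module) ((qFact q s)⁻¹ * e2) •
        Model.up h.hwUp (fun j _ => h.proj hq htop j ((E ^ s) v)) i 0 +
      ((qFact q s)⁻¹ * (qInt q (s + 1))⁻¹ * (qInt q (i + 1))⁻¹ * (qInt q (i + 2))⁻¹ * e3) •
        h.hwDown i (h.proj hq htop (i + 1) ((E ^ (s + 1)) v))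

theorem delta_hwt (i : ℕ) (w : hwt q E K i) : h.delta hq htop (w : V) = Model.single i w := by
  have hw := w.2
  refine Subtype.ext (funext fun j => funext fun s => ?_)
  rw [delta_apply]
  rcases lt_trichotomy s 0 with hs | rfl | hs
  · rw [Model.single_of_ne _ (by omega), h.coord_of_neg hq htop j hs]
  · rw [h.coord_zero]
    by_cases hj : j = i
    · subst hj
      rw [Model.single_same, h.proj_hwt]
    · rw [Model.single_of_ne' _ hj]
      exact h.proj_of_ne hq htop j (n := i) (by omega) hw.1
  · rw [Model.single_of_ne _ (by omega)]
    obtain ⟨t, rfl⟩ : ∃ t : ℕ, s = (t + 1 : ℕ) := ⟨(s - 1).toNat, by omega⟩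
    rw [h.coord_natCast, pow_succ, Module.End.mul_apply, (mem_hwt.mp hw).2, map_zero, map_zero,
      smul_zero]

/-- A nonzero vector in the kernel could be moved, after splitting it into weight vectors, to a
nonzero highest weight vector with vanishing projections. -/
theorem delta_injective : Function.Injective (h.delta hq htop) := by
  rw [← LinearMap.ker_eq_bot]
  have hK : ∀ v ∈ LinearMap.ker (h.delta hq htop), K v ∈ LinearMap.ker (h.delta hq htop) := by
    intro v hv
    rw [LinearMap.mem_ker] at hv ⊢
    rw [delta_K, hv, map_zero]
  have hE : ∀ k : ℕ, ∀ v, h.delta hq htop v = 0 → h.delta hq htop ((E ^ k) v) = 0 := by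
    intro k v hv
    induction k with
    | zero => exact hv
    | succ k ih => rw [pow_succ', Module.End.mul_apply, delta_E, ih, map_zero]
  have hKtop : ⨆ μ, K.genEigenspace μ 1 = ⊤ := by
    rw [eq_top_iff, ← htop]
    exact iSup_le fun n => le_iSup_of_le ((q : ℂ) ^ n) le_rfl
  rw [Submodule.eq_iSup_inf_genEigenspace 1 hK hKtop, eq_bot_iff]
  refine iSup_le fun μ v hv => ?_
  obtain ⟨hv0, hvμ⟩ := hv
  by_contra hne
  by_cases hμ : ∀ n : ℤ, (q : ℂ) ^ n ≠ μ
  · have hbot := eigenspace_eq_bot htop hμ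
    exact hne (hbot ▸ hvμ)
  · push Not at hμ
    obtain ⟨n, rfl⟩ := hμ
    have hvn : v ∈ wt q K n := hvμ
    obtain ⟨k, hk, hk'⟩ := h.exists_E_pow_ne_zero hq hvn hne
    rw [pow_succ', Module.End.mul_apply] at hk'
    have hw : (E ^ k) v ∈ hwt q E K (n + 2 * k) := ⟨h.E_pow_mem hvn k, hk'⟩
    obtain ⟨i, hi⟩ : ∃ i : ℕ, n + 2 * k = i := by
      by_contra hneg
      refine hk (h.hwt_neg hq ?_ hw)
      by_contra hlt
      exact hneg ⟨(n + 2 * k).toNat, by omega⟩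
    rw [hi] at hw
    refine hk ?_
    have h1 := h.delta_hwt hq htop i ⟨_, hw⟩
    rw [hE k v hv0] at h1
    have h2 := congrArg (fun f => f.1 i 0) h1
    simp only [Model.single_same] at h2
    exact (congrArg Subtype.val h2).symm

theorem delta_surjective : Function.Surjective (h.delta hq htop) := by
  rw [← LinearMap.range_eq_top]
  obtain ⟨B, hB⟩ := exists_hwt_bound hq E K
  have hfin := Model.finite_supported (fun i : ℕ => hwt q E K i) hB
  refine (Model.isSchrodinger_act hq (h.hwDown_hwUp_zero hq) (h.hwUp_hwDown hq)).eq_top_of_hwt_le hq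
    (Model.iSup_wt_actK _ hB) (fun i f hf => ?_) ?_
  · rw [Model.eq_single_of_mem_hwt hq hf, ← h.delta_hwt hq htop]
    exact LinearMap.mem_range_self _ _
  · rintro _ ⟨v, rfl⟩
    exact ⟨F v, h.delta_F hq htop v⟩

end IsSchrodinger

end Coord

/-! ### Modules over `U_q(𝔰)` and operators -/

section Rep

variable {q : ℂˣ}

theorem gen_rel {x y : Free} (h : Rel q x y) :
    RingQuot.mkAlgHom ℂ (Rel q) x = RingQuot.mkAlgHom ℂ (Rel q) y :=
  RingQuot.mkAlgHom_rel ℂ h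

/-- To prove a property of all elements of `U_q(𝔰)` it is enough to treat scalars and generators,
and to show that it passes to sums and products. -/
theorem uqs_induction {p : Uqs q → Prop} (hc : ∀ c : ℂ, p (algebraMap ℂ (Uqs q) c))
    (hg : ∀ x : Gen, p (gen q x)) (hadd : ∀ x y, p x → p y → p (x + y))
    (hmul : ∀ x y, p x → p y → p (x * y)) (x : Uqs q) : p x := by
  obtain ⟨x, rfl⟩ := RingQuot.mkAlgHom_surjective ℂ (Rel q) x
  induction x using FreeAlgebra.induction with
  | grade0 c => rw [AlgHom.commutes]; exact hc c
  | grade1 x => exact hg x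
  | mul a b ha hb => rw [map_mul]; exact hmul _ _ ha hb
  | add a b ha hb => rw [map_add]; exact hadd _ _ ha hb

section

variable {V : Type*} [AddCommGroup V] [Module ℂ V] (E F K K' X Y : Module.End ℂ V)

/-- The operators by which the generators act, with `Z` acting by zero. -/
def genOp : Gen → Module.End ℂ V
  | .E => E
  | .F => F
  | .K => K
  | .Kinv => K'
  | .X => X
  | .Y => Y
  | .Z => 0

variable {E F K K' X Y}

theorem IsSchrodinger.genOp_rel (h : IsSchrodinger q E F K K' X Y) ⦃x y : Free⦄ (hr : Rel q x y) :
    FreeAlgebra.lift ℂ (genOp E F K K' X Y) x = FreeAlgebra.lift ℂ (genOp E F K K' X Y) y := by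
  cases hr <;>
    simp only [map_mul, map_one, map_sub, map_add, map_smul, FreeAlgebra.lift_ι_apply] <;>
    refine LinearMap.ext fun v => ?_ <;>
    simp only [genOp, Module.End.mul_apply, LinearMap.sub_apply, LinearMap.add_apply,
      LinearMap.smul_apply, Module.End.one_apply, LinearMap.zero_apply, map_zero]
  case K_Kinv => exact h.K_Kinv v
  case Kinv_K => exact h.Kinv_K v
  case E_F => exact h.comm v
  case K_X => rw [h.K_X, h.K_Kinv]
  case K_E => rw [h.K_E, h.K_Kinv]; norm_cast
  case K_F => rw [h.K_F, h.K_Kinv, zpow_neg]; norm_cast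
  case K_Y => rw [h.K_Y, h.K_Kinv]
  case Y_X => rw [h.X_Y, sub_self]
  case E_X => rw [h.E_X]
  case E_Y => rw [h.E_Y]
  case F_X => rw [h.F_X]
  case F_Y => rw [h.F_Y]

/-- Operators satisfying the relations define a representation of `U_q(𝔰)`. -/
def IsSchrodinger.rep (h : IsSchrodinger q E F K K' X Y) : Uqs q →ₐ[ℂ] Module.End ℂ V :=
  RingQuot.liftAlgHom ℂ ⟨FreeAlgebra.lift ℂ (genOp E F K K' X Y), h.genOp_rel⟩

theorem IsSchrodinger.rep_gen (h : IsSchrodinger q E F K K' X Y) (x : Gen) :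
    h.rep (gen q x) = genOp E F K K' X Y x := by
  rw [IsSchrodinger.rep, gen, RingQuot.liftAlgHom_mkAlgHom_apply, FreeAlgebra.lift_ι_apply]

end

open scoped ModuleCat

/-- The operator by which a generator acts on a module. -/
def act (V : ModuleCat.{u} (Uqs q)) (x : Gen) : Module.End ℂ V := Algebra.lsmul ℂ ℂ V (gen q x)

theorem act_apply (V : ModuleCat.{u} (Uqs q)) (x : Gen) (v : V) : act V x v = gen q x • v := rfl

theorem lsmul_free (V : ModuleCat.{u} (Uqs q)) {x y : Free} (h : Rel q x y) (v : V) :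
    Algebra.lsmul ℂ ℂ V (RingQuot.mkAlgHom ℂ (Rel q) x) v =
      Algebra.lsmul ℂ ℂ V (RingQuot.mkAlgHom ℂ (Rel q) y) v := by
  rw [gen_rel h]

theorem isSchrodinger_of_module (V : ModuleCat.{u} (Uqs q)) (hZ : ∀ v : V, gen q .Z • v = 0) :
    IsSchrodinger q (act V .E) (act V .F) (act V .K) (act V .Kinv) (act V .X) (act V .Y) := by
  have key : ∀ {x y : Free}, Rel q x y → ∀ v : V, _ := fun h v => lsmul_free V h v
  have g1 : ∀ x : Gen, RingQuot.mkAlgHom ℂ (Rel q) (g x) = gen q x := fun _ => rfl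
  have hK : ∀ v : V, gen q .Kinv • gen q .K • v = v := by
    intro v
    simpa [act_apply, g1, mul_smul] using key .Kinv_K v
  constructor
  · constructor
    · intro v; simpa [act_apply, g1, mul_smul] using key .K_Kinv v
    · exact hK
    · intro v; simpa [act_apply, g1, mul_smul, sub_smul, smul_sub] using key .E_F v
    · intro v; simpa [act_apply, g1, mul_smul, hK] using key .K_E (gen q .K • v)
    · intro v; simpa [act_apply, g1, mul_smul, hK] using key .K_F (gen q .K • v)
  · intro v; simpa [act_apply, g1, mul_smul, hK] using key .K_X (gen q .K • v)
  · intro v; simpa [act_apply, g1, mul_smul, hK] using key .K_Y (gen q .K • v)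
  · intro v; simpa [act_apply, g1, mul_smul] using key .E_X v
  · intro v; simpa [act_apply, g1, mul_smul, add_smul] using key .E_Y v
  · intro v; simpa [act_apply, g1, mul_smul, add_smul] using key .F_X v
  · intro v; simpa [act_apply, g1, mul_smul] using key .F_Y v
  · intro v
    have := key .Y_X v
    simp only [map_sub, map_smul, map_mul, LinearMap.sub_apply, LinearMap.smul_apply,
      Module.End.mul_apply, Algebra.lsmul_coe, g1, hZ, sub_eq_zero] at this
    exact this.symm

theorem iSup_wt_of_isTypeOne {V : ModuleCat.{u} (Uqs q)} (h : IsTypeOne q V) :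
    ⨆ n : ℤ, wt q (act V .K) n = ⊤ := by
  rw [eq_top_iff, ← h.1]
  refine iSup_le fun lam => ?_
  by_cases hlam : weightSpace q V lam = ⊥
  · rw [hlam]; exact bot_le
  · obtain ⟨n, rfl⟩ := h.2 hlam
    refine le_iSup_of_le n ?_
    rw [wt, weightSpace, Units.val_zpow_eq_zpow_val]
    exact le_rfl

theorem isTypeOne_of_iSup_wt {V : ModuleCat.{u} (Uqs q)}
    (h : ⨆ n : ℤ, wt q (act V .K) n = ⊤) : IsTypeOne q V := by
  constructor
  · rw [IsWeight, eq_top_iff, ← h]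
    refine iSup_le fun n => le_iSup_of_le (q ^ n) ?_
    rw [wt, weightSpace, Units.val_zpow_eq_zpow_val]
    exact le_rfl
  · intro lam hlam
    by_contra hne
    refine hlam (eigenspace_eq_bot (q := q) h fun n hn => hne ⟨n, ?_⟩)
    exact Units.ext (by simpa using hn)

/-- The space of a representation of `U_q(𝔰)`, as an object of the category of modules. -/
def ofRep {V : Type u} [AddCommGroup V] [Module ℂ V] (ρ : Uqs q →ₐ[ℂ] Module.End ℂ V) :
    ModuleCat.{u} (Uqs q) :=
  letI : Module (Uqs q) V := Module.compHom V ρ.toRingHom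
  ModuleCat.of (Uqs q) V

/-- The complex vector space underlying `ofRep ρ` is the given one. -/
def ofRepEquiv {V : Type u} [AddCommGroup V] [Module ℂ V] (ρ : Uqs q →ₐ[ℂ] Module.End ℂ V) :
    ofRep ρ ≃ₗ[ℂ] V where
  toFun v := v
  map_add' _ _ := rfl
  map_smul' c v := by
    change ρ (algebraMap ℂ (Uqs q) c) v = c • (show V from v)
    rw [AlgHom.commutes]
    rfl
  invFun v := v
  left_inv _ := rfl
  right_inv _ := rfl

theorem ofRepEquiv_smul {V : Type u} [AddCommGroup V] [Module ℂ V]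
    (ρ : Uqs q →ₐ[ℂ] Module.End ℂ V) (x : Uqs q) (v : ofRep ρ) :
    ofRepEquiv ρ (x • v) = ρ x (ofRepEquiv ρ v) := rfl

/-- A complex linear map commuting with the generators is a homomorphism of `U_q(𝔰)`-modules. -/
def homOfCommutes {V W : ModuleCat.{u} (Uqs q)} (f : V →ₗ[ℂ] W)
    (h : ∀ (x : Gen) (v : V), f (gen q x • v) = gen q x • f v) : V →ₗ[Uqs q] W where
  toFun := f
  map_add' := map_add f
  map_smul' x := by
    refine uqs_induction (p := fun x => ∀ v, f (x • v) = x • f v) (fun c v => ?_) h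
      (fun x y hx hy v => ?_) (fun x y hx hy v => ?_) x
    · rw [algebraMap_smul, algebraMap_smul, map_smul]
    · rw [add_smul, add_smul, map_add, hx, hy]
    · rw [mul_smul, mul_smul, hx, hy]

end Rep

/-! ### Homomorphisms from `L(i)` -/

section HomL

open scoped ModuleCat

variable {q : ℂˣ}

theorem L.gen_smul (i : ℕ) (x : Gen) (f : L q i) : gen q x • f = L.op q i x f := by
  change L.rep q i (gen q x) f = _
  rw [L.rep, gen, RingQuot.liftAlgHom_mkAlgHom_apply, FreeAlgebra.lift_ι_apply]

theorem L.algebraMap_smul (i : ℕ) (c : ℂ) (f : L q i) : algebraMap ℂ (Uqs q) c • f = c • f := by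
  change L.rep q i (algebraMap ℂ (Uqs q) c) f = _
  rw [AlgHom.commutes]
  rfl

theorem gen_mem_uqSl2 {x : Gen} (hx : x = .E ∨ x = .F ∨ x = .K ∨ x = .Kinv) :
    gen q x ∈ UqSl2 q := by
  refine Algebra.subset_adjoin ?_
  rcases hx with rfl | rfl | rfl | rfl <;> simp

/-- A complex linear map out of `L(i)` commuting with `E`, `F`, `K` and `K⁻¹` is
`U_q(𝔰𝔩₂)`-linear. -/
def homLOfCommutes {V : ModuleCat.{u} (Uqs q)} {i : ℕ} (f : L q i →ₗ[ℂ] V)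
    (h : ∀ (x : Gen), (x = .E ∨ x = .F ∨ x = .K ∨ x = .Kinv) →
      ∀ v, f (gen q x • v) = gen q x • f v) :
    HomL q V i where
  toFun := f
  map_add' := map_add f
  map_smul' x := by
    obtain ⟨x, hx⟩ := x
    change ∀ v, f (x • v) = x • f v
    induction hx using Algebra.adjoin_induction with
    | mem x hx =>
      rcases hx with rfl | rfl | rfl | rfl <;> exact h _ (by simp)
    | algebraMap c => intro v; rw [L.algebraMap_smul, _root_.algebraMap_smul, map_smul]
    | add x y _ _ hx hy => intro v; rw [add_smul, add_smul, map_add, hx, hy]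
    | mul x y _ _ hx hy => intro v; rw [mul_smul, mul_smul, hx, hy]

theorem HomL.map_gen {V : ModuleCat.{u} (Uqs q)} {i : ℕ} (θ : HomL q V i) {x : Gen}
    (hx : x = .E ∨ x = .F ∨ x = .K ∨ x = .Kinv) (f : L q i) :
    θ (gen q x • f) = gen q x • θ f :=
  θ.map_smul ⟨gen q x, gen_mem_uqSl2 hx⟩ f

/-- A `U_q(𝔰𝔩₂)`-linear map is complex linear. -/
def HomL.toLin {V : ModuleCat.{u} (Uqs q)} {i : ℕ} (θ : HomL q V i) : L q i →ₗ[ℂ] V where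
  toFun := θ
  map_add' := map_add θ
  map_smul' c f := by
    have h := θ.map_smul (algebraMap ℂ (UqSl2 q) c) f
    change θ (algebraMap ℂ (Uqs q) c • f) = algebraMap ℂ (Uqs q) c • θ f at h
    rwa [L.algebraMap_smul, _root_.algebraMap_smul] at h

theorem L.v_apply_zero (i : ℕ) : L.v q i (0 : Fin (i + 1)) = 1 := rfl

theorem L.v_mem_hwt (i : ℕ) : gen q .E • L.v q i = 0 ∧
    gen q .K • L.v q i = (q : ℂ) ^ (i : ℤ) • L.v q i := by
  rw [L.gen_smul, L.gen_smul]
  constructor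
  · funext s
    change L.opE q i (L.v q i) s = 0
    rw [L.opE_apply]
    split_ifs with h
    · simp [L.v]
    · rfl
  · funext s
    change (q : ℂ) ^ ((i : ℤ) - 2 * (s : ℕ)) * L.v q i s = (q : ℂ) ^ (i : ℤ) * L.v q i s
    by_cases hs : (s : ℕ) = 0
    · simp [hs]
    · simp [L.v, hs]

theorem L.F_pow_v (i : ℕ) (t : ℕ) (s : Fin (i + 1)) :
    (L.opF q i ^ t) (L.v q i) s = if (s : ℕ) = t then 1 else 0 := by
  induction t generalizing s with
  | zero => rfl
  | succ t ih =>
    rw [pow_succ', Module.End.mul_apply, L.opF_apply]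
    split_ifs with h1 h2 h2
    · rw [ih, if_pos (by simp; omega)]
    · rw [ih, if_neg (by simp; omega)]
    · omega
    · rfl

/-- The vectors `F ^ s v_i` form a basis of `L(i)`. -/
theorem L.eq_sum (i : ℕ) (f : L q i) :
    f = ∑ s : Fin (i + 1), f s • (L.opF q i ^ (s : ℕ)) (L.v q i) := by
  funext t
  have h1 : (∑ s : Fin (i + 1), f s • (L.opF q i ^ (s : ℕ)) (L.v q i)) t =
      ∑ s : Fin (i + 1), f s * (L.opF q i ^ (s : ℕ)) (L.v q i) t :=
    Finset.sum_apply t Finset.univ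
      (fun s : Fin (i + 1) => (f s • (L.opF q i ^ (s : ℕ)) (L.v q i) : Fin (i + 1) → ℂ))
  rw [h1, Finset.sum_eq_single t]
  · rw [L.F_pow_v, if_pos rfl, mul_one]
  · intro s _ hs
    rw [L.F_pow_v, if_neg (fun h => hs (Fin.ext h.symm)), mul_zero]
  · simp

variable (hq : ∀ n : ℕ, 0 < n → q ^ n ≠ 1) (V : ModuleCat.{u} (Uqs q))

/-- The linear map `L(i) → V` which sends `F ^ s v_i` to `F ^ s w`. -/
def homLLin (i : ℕ) (w : V) : L q i →ₗ[ℂ] V where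
  toFun f := ∑ s : Fin (i + 1), f s • (act V .F ^ (s : ℕ)) w
  map_add' f f' := by
    rw [← Finset.sum_add_distrib]
    exact Finset.sum_congr rfl fun s _ => add_smul _ _ _
  map_smul' c f := by
    rw [RingHom.id_apply, Finset.smul_sum]
    exact Finset.sum_congr rfl fun s _ => mul_smul _ _ _

theorem homLLin_apply (i : ℕ) (w : V) (f : L q i) :
    homLLin V i w f = ∑ s : Fin (i + 1), f s • (act V .F ^ (s : ℕ)) w := rfl

/-- If `w` is a highest weight vector of weight `i`, then `F ^ s v_i ↦ F ^ s w` is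
`U_q(𝔰𝔩₂)`-linear; for `F` this uses `F ^ (i + 1) w = 0`. -/
theorem homLLin_gen (hq : ∀ n : ℕ, 0 < n → q ^ n ≠ 1) [Module.Finite ℂ V] (hZ : ∀ v : V, gen q .Z • v = 0) (i : ℕ) {w : V}
    (hw : w ∈ hwt q (act V .E) (act V .K) i) (x : Gen)
    (hx : x = .E ∨ x = .F ∨ x = .K ∨ x = .Kinv) (f : L q i) :
    homLLin V i w (gen q x • f) = gen q x • homLLin V i w f := by
  have h := isSchrodinger_of_module V hZ
  rw [L.gen_smul, ← act_apply V x, homLLin_apply, homLLin_apply, map_sum]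
  simp only [map_smul]
  rcases hx with rfl | rfl | rfl | rfl
  · change ∑ s, L.opE q i f s • _ = _
    rw [Fin.sum_univ_castSucc, Fin.sum_univ_succ]
    have h0 : L.opE q i f (Fin.last i) = 0 := by rw [L.opE_apply, dif_neg (by simp)]
    have h1 : act V .E ((act V .F ^ ((0 : Fin (i + 1)) : ℕ)) w) = 0 := (mem_hwt.mp hw).2
    rw [h0, h1, zero_smul, smul_zero, add_zero, zero_add]
    refine Finset.sum_congr rfl fun t _ => ?_
    rw [L.opE_apply, dif_pos (by simp), Fin.val_succ, h.E_F_pow hq _ hw.1, (mem_hwt.mp hw).2,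
      map_zero, zero_add, smul_smul, mul_comm]
    rfl
  · change ∑ s, L.opF q i f s • _ = _
    rw [Fin.sum_univ_castSucc (fun s => f s • _), Fin.sum_univ_succ]
    have h0 : L.opF q i f 0 = 0 := by rw [L.opF_apply, dif_neg (by simp)]
    have h1 : act V .F ((act V .F ^ ((Fin.last i : Fin (i + 1)) : ℕ)) w) = 0 := by
      rw [← Module.End.mul_apply, ← pow_succ']
      exact h.F_pow_hwt hq hw
    rw [h0, h1, zero_smul, smul_zero, add_zero, zero_add]
    refine Finset.sum_congr rfl fun t _ => ?_
    rw [L.opF_apply, dif_pos (by simp), ← Module.End.mul_apply, ← pow_succ']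
    rfl
  · refine Finset.sum_congr rfl fun s _ => ?_
    change ((q : ℂ) ^ ((i : ℤ) - 2 * (s : ℕ)) * f s) • _ = _
    rw [mem_wt.mp (h.F_pow_mem hw.1 s), smul_smul, mul_comm]
  · refine Finset.sum_congr rfl fun s _ => ?_
    change ((q : ℂ) ^ (-((i : ℤ) - 2 * (s : ℕ))) * f s) • _ = _
    rw [h.Kinv_of_wt (h.F_pow_mem hw.1 s), smul_smul, mul_comm]

theorem homLLin_v (i : ℕ) (w : V) : homLLin V i w (L.v q i) = w := by
  rw [homLLin_apply, Fin.sum_univ_succ, L.v_apply_zero]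
  simp [L.v]

/-- Homomorphisms `L(i) → V` correspond to highest weight vectors of weight `i`, the images
of `v_i`. -/
def homLEquiv [Module.Finite ℂ V] (hZ : ∀ v : V, gen q .Z • v = 0) (i : ℕ) :
    hwt q (act V .E) (act V .K) i ≃ₗ[ℂ] HomL q V i where
  toFun w := homLOfCommutes (homLLin V i w) (homLLin_gen V hq hZ i w.2)
  map_add' w w' := by
    refine LinearMap.ext fun f => ?_
    change homLLin V i (w + w' : V) f = homLLin V i w f + homLLin V i w' f
    simp only [homLLin_apply, map_add, smul_add, Finset.sum_add_distrib]
  map_smul' c w := by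
    refine LinearMap.ext fun f => ?_
    change homLLin V i (c • (w : V)) f = c • homLLin V i w f
    simp only [homLLin_apply, map_smul, Finset.smul_sum]
    exact Finset.sum_congr rfl fun s _ => smul_comm _ _ _
  invFun θ := ⟨θ (L.v q i), by
    rw [mem_hwt, act_apply, act_apply, ← θ.map_gen (by simp), ← θ.map_gen (by simp),
      (L.v_mem_hwt i).1, (L.v_mem_hwt i).2, map_zero]
    exact ⟨θ.toLin.map_smul _ _, rfl⟩⟩
  left_inv w := Subtype.ext (homLLin_v V i w)
  right_inv θ := by
    refine LinearMap.ext fun f => ?_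
    change homLLin V i (θ (L.v q i)) f = θ.toLin f
    have hF : ∀ t : ℕ, θ.toLin ((L.opF q i ^ t) (L.v q i)) = (act V .F ^ t) (θ (L.v q i)) := by
      intro t
      induction t with
      | zero => rfl
      | succ t ih =>
        rw [pow_succ', pow_succ', Module.End.mul_apply, Module.End.mul_apply, ← ih]
        have := θ.map_gen (x := .F) (by simp) ((L.opF q i ^ t) (L.v q i))
        rw [L.gen_smul] at this
        exact this
    conv_rhs => rw [L.eq_sum i f, map_sum]
    rw [homLLin_apply]
    refine Finset.sum_congr rfl fun s _ => ?_
    rw [map_smul, hF]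

theorem homLEquiv_apply [Module.Finite ℂ V] (hZ : ∀ v : V, gen q .Z • v = 0) (i : ℕ)
    (w : hwt q (act V .E) (act V .K) i) (f : L q i) :
    homLEquiv hq V hZ i w f = ∑ s : Fin (i + 1), f s • (act V .F ^ (s : ℕ)) (w : V) := rfl

theorem homLEquiv_v [Module.Finite ℂ V] (hZ : ∀ v : V, gen q .Z • v = 0) (i : ℕ)
    (w : hwt q (act V .E) (act V .K) i) : homLEquiv hq V hZ i w (L.v q i) = w :=
  homLLin_v V i w

end HomL

/-! ### Representations of the quiver -/

namespace QRep

/-- The representation of `Q_∞` given by spaces `M i` and maps `a i`, `b i`. -/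
def mk (M : ℕ → Type u) [∀ i, AddCommGroup (M i)] [∀ i, Module ℂ (M i)]
    (a : ∀ i, M i →ₗ[ℂ] M (i + 1)) (b : ∀ i, M (i + 1) →ₗ[ℂ] M i) : QRep.{u} :=
  Paths.lift
    { obj := fun x => ModuleCat.of ℂ (M x.idx)
      map := fun {_ _} f => match f with
        | .a i => ModuleCat.ofHom (a i)
        | .b i => ModuleCat.ofHom (b i) }

/-- A family of maps which is natural with respect to the arrows is natural with respect to all
paths. -/
theorem naturality_of_arrows {M N : QRep.{u}} (η : ∀ x : Paths QInf, M.obj x ⟶ N.obj x)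
    (h : ∀ {x y : QInf} (e : x ⟶ y), M.map ((Paths.of QInf).map e) ≫ η ((Paths.of QInf).obj y) =
      η ((Paths.of QInf).obj x) ≫ N.map ((Paths.of QInf).map e))
    {x y : Paths QInf} (p : x ⟶ y) : M.map p ≫ η y = η x ≫ N.map p := by
  induction p using Paths.induction with
  | id => rw [M.map_id, N.map_id, Category.id_comp, Category.comp_id]
  | comp p e hp =>
    rw [M.map_comp, N.map_comp, Category.assoc, h, ← Category.assoc, hp, Category.assoc]

/-- Linear maps at the vertices which commute with the maps along the arrows form a morphism of
representations. -/
def homMk {M N : QRep.{u}} (f : ∀ i, M.space i →ₗ[ℂ] N.space i)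
    (ha : ∀ i x, f (i + 1) (M.a i x) = N.a i (f i x))
    (hb : ∀ i x, f i (M.b i x) = N.b i (f (i + 1) x)) : M ⟶ N where
  app x := ModuleCat.ofHom (f x.idx)
  naturality _ _ p := by
    refine naturality_of_arrows (M := M) (N := N) (fun x => ModuleCat.ofHom (f x.idx)) ?_ p
    intro x y (e : QInf.Arrow x y)
    cases e with
    | a i => exact ModuleCat.hom_ext (LinearMap.ext fun v => ha i v)
    | b i => exact ModuleCat.hom_ext (LinearMap.ext fun v => hb i v)

theorem hom_a {M N : QRep.{u}} (f : M ⟶ N) (i : ℕ) (x : M.space i) :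
    (f.app ((Paths.of QInf).obj ⟨i + 1⟩)).hom (M.a i x) =
      N.a i ((f.app ((Paths.of QInf).obj ⟨i⟩)).hom x) :=
  LinearMap.congr_fun (congrArg ModuleCat.Hom.hom
    (f.naturality ((Paths.of QInf).map (QInf.Arrow.a i)))) x

theorem hom_b {M N : QRep.{u}} (f : M ⟶ N) (i : ℕ) (x : M.space (i + 1)) :
    (f.app ((Paths.of QInf).obj ⟨i⟩)).hom (M.b i x) =
      N.b i ((f.app ((Paths.of QInf).obj ⟨i + 1⟩)).hom x) :=
  LinearMap.congr_fun (congrArg ModuleCat.Hom.hom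
    (f.naturality ((Paths.of QInf).map (QInf.Arrow.b i)))) x

theorem hom_ext {M N : QRep.{u}} {f g : M ⟶ N}
    (h : ∀ i x, (f.app ((Paths.of QInf).obj ⟨i⟩)).hom x =
      (g.app ((Paths.of QInf).obj ⟨i⟩)).hom x) : f = g :=
  NatTrans.ext (funext fun x => ModuleCat.hom_ext (LinearMap.ext fun v => h x.idx v))

/-- Linear equivalences at the vertices which commute with the maps along the arrows form an
isomorphism of representations. -/
def isoMk {M N : QRep.{u}} (e : ∀ i, M.space i ≃ₗ[ℂ] N.space i)
    (ha : ∀ i x, e (i + 1) (M.a i x) = N.a i (e i x))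
    (hb : ∀ i x, e i (M.b i x) = N.b i (e (i + 1) x)) : M ≅ N where
  hom := homMk (fun i => (e i).toLinearMap) ha hb
  inv := homMk (fun i => (e i).symm.toLinearMap)
    (fun i x => by
      change (e (i + 1)).symm _ = M.a i ((e i).symm x)
      rw [LinearEquiv.symm_apply_eq, ha, LinearEquiv.apply_symm_apply])
    (fun i x => by
      change (e i).symm _ = M.b i ((e (i + 1)).symm x)
      rw [LinearEquiv.symm_apply_eq, hb, LinearEquiv.apply_symm_apply])
  hom_inv_id := hom_ext fun i x => (e i).symm_apply_apply x
  inv_hom_id := hom_ext fun i x => (e i).apply_symm_apply x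

end QRep

/-! ### The functor `Φ` -/

section Functor

open scoped ModuleCat

variable {q : ℂˣ} (hq : ∀ n : ℕ, 0 < n → q ^ n ≠ 1)

namespace CatA

variable (V : CatA.{u} q)

instance : Module.Finite ℂ V.obj := V.property.1

theorem smul_Z (v : V.obj) : gen q .Z • v = 0 := V.property.2.2 v

theorem isSchrodinger : IsSchrodinger q (act V.obj .E) (act V.obj .F) (act V.obj .K)
    (act V.obj .Kinv) (act V.obj .X) (act V.obj .Y) :=
  isSchrodinger_of_module V.obj (smul_Z V)

theorem iSup_wt : ⨆ n : ℤ, wt q (act V.obj .K) n = ⊤ := iSup_wt_of_isTypeOne V.property.2.1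

/-- The highest weight vectors of weight `i` in an object of `𝒜`. -/
abbrev hw (i : ℕ) : Submodule ℂ V.obj := hwt q (act V.obj .E) (act V.obj .K) i

variable {V} in
theorem map_act {W : CatA.{u} q} (f : V ⟶ W) (x : Gen) (v : V.obj) :
    f.hom.hom (act V.obj x v) = act W.obj x (f.hom.hom v) := map_smul f.hom.hom _ _

variable {V} in
/-- A morphism of `𝒜` as a complex linear map. -/
def toLin {W : CatA.{u} q} (f : V ⟶ W) : V.obj →ₗ[ℂ] W.obj where
  toFun := f.hom.hom
  map_add' := map_add f.hom.hom
  map_smul' c v := map_smul f.hom.hom (algebraMap ℂ (Uqs q) c) v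

variable {V} in
theorem map_mem_hw {W : CatA.{u} q} (f : V ⟶ W) {i : ℕ} {v : V.obj} (hv : v ∈ hw V i) :
    toLin f v ∈ hw W i := by
  rw [mem_hwt] at hv ⊢
  constructor
  · rw [← map_smul (toLin f), ← hv.1]
    exact (map_act f .K v).symm
  · rw [← map_zero (toLin f), ← hv.2]
    exact (map_act f .E v).symm

variable {V} in
/-- The map induced by a morphism on highest weight vectors. -/
def hwMap {W : CatA.{u} q} (f : V ⟶ W) (i : ℕ) : hw V i →ₗ[ℂ] hw W i :=
  (toLin f).restrict fun _ hv => map_mem_hw f hv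

end CatA

theorem propB_hw {q : ℂˣ} (hq : ∀ n : ℕ, 0 < n → q ^ n ≠ 1) (V : CatA.{u} q) :
    propB (QRep.mk (fun i => CatA.hw V i) (CatA.isSchrodinger V).hwUp
      (CatA.isSchrodinger V).hwDown) := by
  refine ⟨⟨fun i => inferInstanceAs (Module.Finite ℂ (CatA.hw V i)), ?_⟩,
    (CatA.isSchrodinger V).hwDown_hwUp_zero hq, (CatA.isSchrodinger V).hwUp_hwDown hq⟩
  obtain ⟨B, hB⟩ := exists_hwt_bound hq (act V.obj .E) (act V.obj .K)
  refine (Set.finite_lt_nat B).subset fun i hi => ?_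
  by_contra hBi
  have h1 : Subsingleton (CatA.hw V i) := hB i (not_lt.mp hBi)
  exact not_nontrivial_iff_subsingleton.mpr h1 hi

/-- The functor sending a module to the quiver representation on its highest weight vectors. -/
def hwFunctor : CatA.{u} q ⥤ CatB.{u} where
  obj V := ⟨QRep.mk (fun i => CatA.hw V i) (CatA.isSchrodinger V).hwUp
    (CatA.isSchrodinger V).hwDown, propB_hw hq V⟩
  map {V W} f := ObjectProperty.homMk (QRep.homMk (CatA.hwMap f)
    (fun i x => Subtype.ext (CatA.map_act f .X x.1))
    (fun i x => by
      refine Subtype.ext ?_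
      change CatA.toLin f (qInt q (i + 1) • act V.obj .Y x.1 -
          (q : ℂ)⁻¹ • act V.obj .X (act V.obj .F x.1)) =
        qInt q (i + 1) • act W.obj .Y (CatA.toLin f x.1) -
          (q : ℂ)⁻¹ • act W.obj .X (act W.obj .F (CatA.toLin f x.1))
      have h1 : ∀ (y : Gen) v, CatA.toLin f (act V.obj y v) = act W.obj y (CatA.toLin f v) :=
        CatA.map_act f
      rw [map_sub, map_smul, map_smul, h1, h1, h1]))
  map_id V := by
    refine ObjectProperty.hom_ext _ (QRep.hom_ext fun i x => ?_)
    rfl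
  map_comp f g := by
    refine ObjectProperty.hom_ext _ (QRep.hom_ext fun i x => ?_)
    rfl

/-! ### The functor is an equivalence -/

instance : (hwFunctor.{u} hq).Faithful where
  map_injective {V W} f g hfg := by
    have htop : LinearMap.eqLocus (CatA.toLin f) (CatA.toLin g) = ⊤ := by
      refine (CatA.isSchrodinger V).eq_top_of_hwt_le hq (CatA.iSup_wt V) (fun i w hw => ?_)
        (fun v hv => ?_)
      · have h1 := congrArg
          (fun φ => (CatB.component φ i (⟨w, hw⟩ : CatA.hw V i) : CatA.hw W i).1) hfg
        exact h1
      · rw [LinearMap.mem_eqLocus] at hv ⊢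
        exact (CatA.map_act f .F v).trans ((congrArg _ hv).trans (CatA.map_act g .F v).symm)
    refine ObjectProperty.hom_ext _ (ModuleCat.hom_ext (LinearMap.ext fun v => ?_))
    have : v ∈ LinearMap.eqLocus (CatA.toLin f) (CatA.toLin g) := htop ▸ Submodule.mem_top
    exact this

namespace Model

variable {M N : ℕ → Type u} [∀ i, AddCommGroup (M i)] [∀ i, Module ℂ (M i)]
  [∀ i, AddCommGroup (N i)] [∀ i, Module ℂ (N i)]

/-- Linear maps `M i → N i` induce a map `⨁ i, L(i) ⊗ M i → ⨁ i, L(i) ⊗ N i`. -/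
def map (f : ∀ i, M i →ₗ[ℂ] N i) : supported M →ₗ[ℂ] supported N where
  toFun x := ⟨fun i s => f i (x.1 i s), fun i s hs => by
    change f i (x.1 i s) = 0
    rw [x.2 i s hs, map_zero]⟩
  map_add' x y := Subtype.ext (funext fun i => funext fun _ => map_add (f i) _ _)
  map_smul' c x := Subtype.ext (funext fun i => funext fun _ => map_smul (f i) _ _)

theorem map_apply (f : ∀ i, M i →ₗ[ℂ] N i) (x : supported M) (i : ℕ) (s : ℤ) :
    (map f x).1 i s = f i (x.1 i s) := rfl

theorem map_genOp {f : ∀ i, M i →ₗ[ℂ] N i} {a : ∀ i, M i →ₗ[ℂ] M (i + 1)}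
    {b : ∀ i, M (i + 1) →ₗ[ℂ] M i} {a' : ∀ i, N i →ₗ[ℂ] N (i + 1)}
    {b' : ∀ i, N (i + 1) →ₗ[ℂ] N i} (ha : ∀ i x, f (i + 1) (a i x) = a' i (f i x))
    (hb : ∀ i x, f i (b i x) = b' i (f (i + 1) x)) (y : Gen) (x : supported M) :
    map f (genOp (actE M q) (actF M q) (actK M q) (actK' M q) (actX q a b) (actY q a b) y x) =
      genOp (actE N q) (actF N q) (actK N q) (actK' N q) (actX q a' b') (actY q a' b') y
        (map f x) := by
  have hup : ∀ i s, f i (up a x.1 i s) = up a' (map f x).1 i s := by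
    intro i s
    cases i with
    | zero => exact map_zero _
    | succ i => exact ha i _
  have hdown : ∀ i s, f i (down b x.1 i s) = down b' (map f x).1 i s := fun i s => hb i _
  cases y <;> refine Subtype.ext (funext fun i => funext fun s => ?_)
  case E => exact map_smul (f i) _ _
  case F => exact map_smul (f i) _ _
  case K => exact map_smul (f i) _ _
  case Kinv => exact map_smul (f i) _ _
  case X =>
    change f i (opX q a b x.1 i s) = opX q a' b' (map f x).1 i s
    rw [opX_apply, opX_apply, map_sub, map_smul, map_smul, hup, hdown]
  case Y =>
    change f i (opY q a b x.1 i s) = opY q a' b' (map f x).1 i s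
    rw [opY_apply, opY_apply, map_add, map_smul, hup, hdown]
  case Z => exact map_zero _

theorem map_single (f : ∀ i, M i →ₗ[ℂ] N i) (i : ℕ) (m : M i) :
    map f (single i m) = single i (f i m) := by
  refine Subtype.ext (funext fun j => funext fun s => ?_)
  rw [map_apply]
  by_cases hs : s = 0
  · by_cases hj : j = i
    · subst hs hj; rw [single_same, single_same]
    · rw [single_of_ne' _ hj, single_of_ne' _ hj, map_zero]
  · rw [single_of_ne _ hs, single_of_ne _ hs, map_zero]

end Model

/-- Every object of `𝒜` is isomorphic, through the coefficient map, to the module constructed from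
its highest weight vectors. -/
def CatA.deltaEquiv (V : CatA.{u} q) :
    V.obj ≃ₗ[ℂ] Model.supported (fun i : ℕ => CatA.hw V i) :=
  LinearEquiv.ofBijective ((CatA.isSchrodinger V).delta hq (CatA.iSup_wt V))
    ⟨(CatA.isSchrodinger V).delta_injective hq _, (CatA.isSchrodinger V).delta_surjective hq _⟩

theorem CatA.deltaEquiv_smul (V : CatA.{u} q) (x : Gen) (v : V.obj) :
    CatA.deltaEquiv hq V (gen q x • v) =
      genOp (Model.actE _ q) (Model.actF _ q) (Model.actK _ q) (Model.actK' _ q)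
        (Model.actX q (CatA.isSchrodinger V).hwUp (CatA.isSchrodinger V).hwDown)
        (Model.actY q (CatA.isSchrodinger V).hwUp (CatA.isSchrodinger V).hwDown) x
        (CatA.deltaEquiv hq V v) := by
  cases x
  case E => exact (CatA.isSchrodinger V).delta_E hq _ v
  case F => exact (CatA.isSchrodinger V).delta_F hq _ v
  case K => exact (CatA.isSchrodinger V).delta_K hq _ v
  case Kinv => exact (CatA.isSchrodinger V).delta_Kinv hq _ v
  case X => exact (CatA.isSchrodinger V).delta_X hq _ v
  case Y => exact (CatA.isSchrodinger V).delta_Y hq _ v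
  case Z => rw [CatA.smul_Z, map_zero]; rfl

theorem CatA.deltaEquiv_hw (V : CatA.{u} q) (i : ℕ) (w : CatA.hw V i) :
    CatA.deltaEquiv hq V (w : V.obj) = Model.single (M := fun i : ℕ => CatA.hw V i) i w :=
  (CatA.isSchrodinger V).delta_hwt hq _ i w

instance : (hwFunctor.{u} hq).Full where
  map_surjective {V W} φ := by
    let f : ∀ i, CatA.hw V i →ₗ[ℂ] CatA.hw W i := fun i => CatB.component φ i
    have ha : ∀ i x, f (i + 1) ((CatA.isSchrodinger V).hwUp i x) =
        (CatA.isSchrodinger W).hwUp i (f i x) := fun i x => QRep.hom_a φ.hom i x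
    have hb : ∀ i x, f i ((CatA.isSchrodinger V).hwDown i x) =
        (CatA.isSchrodinger W).hwDown i (f (i + 1) x) := fun i x => QRep.hom_b φ.hom i x
    let F : V.obj →ₗ[ℂ] W.obj := (CatA.deltaEquiv hq W).symm.toLinearMap ∘ₗ Model.map f ∘ₗ
      (CatA.deltaEquiv hq V).toLinearMap
    have hF : ∀ v, CatA.deltaEquiv hq W (F v) = Model.map f (CatA.deltaEquiv hq V v) :=
      fun v => LinearEquiv.apply_symm_apply _ _
    refine ⟨ObjectProperty.homMk (ModuleCat.ofHom (homOfCommutes F fun x v => ?_)), ?_⟩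
    · apply (CatA.deltaEquiv hq W).injective
      rw [hF, CatA.deltaEquiv_smul, CatA.deltaEquiv_smul, hF, Model.map_genOp ha hb]
    · refine ObjectProperty.hom_ext _ (QRep.hom_ext fun i w => Subtype.ext ?_)
      let w' : CatA.hw V i := w
      change F w'.1 = (f i w').1
      apply (CatA.deltaEquiv hq W).injective
      rw [hF, CatA.deltaEquiv_hw, CatA.deltaEquiv_hw, Model.map_single]

/-- Operators on a finite-dimensional space which satisfy the relations, with `K` diagonalizable with
integral powers of `q` as eigenvalues, define an object of `𝒜`. -/
theorem propA_ofRep {V : Type u} [AddCommGroup V] [Module ℂ V] [Module.Finite ℂ V]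
    {E F K K' X Y : Module.End ℂ V} (h : IsSchrodinger q E F K K' X Y)
    (htop : ⨆ n : ℤ, wt q K n = ⊤) : propA q (ofRep h.rep) := by
  refine ⟨Module.Finite.equiv (ofRepEquiv h.rep).symm, isTypeOne_of_iSup_wt ?_, fun v => ?_⟩
  · have h1 : ∀ n, wt q (act (ofRep h.rep) .K) n =
        (wt q K n).map (ofRepEquiv h.rep).symm.toLinearMap := by
      intro n
      ext v
      rw [Submodule.mem_map_equiv, LinearEquiv.symm_symm, mem_wt, mem_wt,
        ← (ofRepEquiv h.rep).injective.eq_iff, act_apply, ofRepEquiv_smul, h.rep_gen, map_smul]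
      rfl
    simp_rw [h1]
    rw [← Submodule.map_iSup, htop, Submodule.map_top]
    exact LinearEquiv.range _
  · apply (ofRepEquiv h.rep).injective
    rw [ofRepEquiv_smul, h.rep_gen, map_zero]
    rfl

instance : (hwFunctor.{u} hq).EssSurj where
  mem_essImage N := by
    obtain ⟨⟨hfin, hsupp⟩, h0, h1⟩ := N.property
    obtain ⟨B, hB⟩ : ∃ B : ℕ, ∀ i : ℕ, B ≤ i → Subsingleton (N.obj.space i) := by
      obtain ⟨B, hB⟩ := hsupp.bddAbove
      refine ⟨B + 1, fun i hi => not_nontrivial_iff_subsingleton.mp fun hn => ?_⟩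
      have := hB hn
      omega
    let M : ℕ → Type u := fun i => N.obj.space i
    have h := Model.isSchrodinger_act (M := M) hq h0 h1
    have := Model.finite_supported M hB
    let V : CatA.{u} q := ⟨ofRep h.rep, propA_ofRep h (Model.iSup_wt_actK M hB)⟩
    have hgen : ∀ (x : Gen) (v : V.obj), ofRepEquiv h.rep (act V.obj x v) =
        genOp _ _ _ _ _ _ x (ofRepEquiv h.rep v) := fun x v => by
      rw [act_apply, ofRepEquiv_smul, h.rep_gen]
    have hmem : ∀ (i : ℕ) (v : V.obj), v ∈ CatA.hw V i ↔
        ofRepEquiv h.rep v ∈ hwt q (Model.actE M q) (Model.actK M q) i := fun i v => by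
      rw [mem_hwt, mem_hwt, ← (ofRepEquiv h.rep).injective.eq_iff, hgen, map_smul,
        ← (ofRepEquiv h.rep).injective.eq_iff, hgen, map_zero]
      rfl
    let e : ∀ i, CatA.hw V i ≃ₗ[ℂ] M i := fun i =>
      ((ofRepEquiv h.rep).ofSubmodules (CatA.hw V i) _ (by
        ext v
        rw [Submodule.mem_map_equiv, hmem, LinearEquiv.apply_symm_apply])) ≪≫ₗ
        Model.hwtEquiv M hq i
    have he : ∀ i (w : CatA.hw V i), e i w = (ofRepEquiv h.rep (w : V.obj)).1 i 0 := fun i w => rfl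
    refine ⟨V, ⟨ObjectProperty.isoMk _ (QRep.isoMk e (fun i w => ?_) (fun i w => ?_))⟩⟩
    · let w' : CatA.hw V i := w
      change e (i + 1) ((CatA.isSchrodinger V).hwUp i w') = N.obj.a i (e i w')
      rw [he, he, IsSchrodinger.coe_hwUp, hgen]
      exact Model.actX_apply_zero ((hmem i w').mp w'.2) hq
    · let w' : CatA.hw V (i + 1) := w
      change e i ((CatA.isSchrodinger V).hwDown i w') = N.obj.b i (e (i + 1) w')
      rw [he, he, IsSchrodinger.coe_hwDown, map_sub, map_smul, map_smul, hgen, hgen, hgen]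
      exact Model.actY_apply_zero i _ hq

instance : (hwFunctor.{u} hq).IsEquivalence where

end Functor

end QuantumSchrodinger

end

open QuantumSchrodinger CategoryTheory in
open scoped ModuleCat in
theorem mainTheorem2 (q : ℂˣ) (hq : ∀ n : ℕ, 0 < n → q ^ n ≠ 1) :
    ∃ Φ : CatA.{u} q ⥤ CatB.{u}, Φ.IsEquivalence ∧
      ∃ e : ∀ (V : CatA.{u} q) (i : ℕ), (Φ.obj V).obj.space i ≃ₗ[ℂ] HomL q V.obj i,
        (∀ (V W : CatA.{u} q) (f : V ⟶ W) (i : ℕ) (x : (Φ.obj V).obj.space i) (w : L q i),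
          e W i (CatB.component (Φ.map f) i x) w = f.hom (e V i x w)) ∧
        (∀ (V : CatA.{u} q) (i : ℕ) (x : (Φ.obj V).obj.space i),
          e V (i + 1) ((Φ.obj V).obj.a i x) (L.v q (i + 1)) = gen q .X • e V i x (L.v q i)) ∧
        (∀ (V : CatA.{u} q) (i : ℕ) (x : (Φ.obj V).obj.space (i + 1)),
          e V i ((Φ.obj V).obj.b i x) (L.v q i) =
            qInt q (i + 1) • gen q .Y • e V (i + 1) x (L.v q (i + 1)) -
              (q : ℂ)⁻¹ • gen q .X • gen q .F • e V (i + 1) x (L.v q (i + 1))) := by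
  refine ⟨hwFunctor hq, inferInstance,
    fun V i => homLEquiv hq V.obj (CatA.smul_Z V) i, fun V W f i x w => ?_, fun V i x => ?_,
    fun V i x => ?_⟩
  · let y : CatA.hw V i := x
    change homLEquiv hq W.obj (CatA.smul_Z W) i (CatA.hwMap f i y) w =
      CatA.toLin f (homLEquiv hq V.obj (CatA.smul_Z V) i y w)
    have hF : ∀ t : ℕ, CatA.toLin f ((act V.obj .F ^ t) y.1) =
        (act W.obj .F ^ t) (CatA.toLin f y.1) := by
      intro t
      induction t with
      | zero => rfl
      | succ t ih =>
        rw [pow_succ', pow_succ', Module.End.mul_apply, Module.End.mul_apply, ← ih]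
        exact CatA.map_act f .F _
    rw [homLEquiv_apply, homLEquiv_apply, map_sum]
    refine Finset.sum_congr rfl fun s _ => ?_
    rw [map_smul, hF]
    rfl
  · let y : CatA.hw V i := x
    change homLEquiv hq V.obj (CatA.smul_Z V) (i + 1) ((CatA.isSchrodinger V).hwUp i y) _ =
      gen q .X • homLEquiv hq V.obj (CatA.smul_Z V) i y _
    rw [homLEquiv_v, homLEquiv_v]
    rfl
  · let y : CatA.hw V (i + 1) := x
    change homLEquiv hq V.obj (CatA.smul_Z V) i ((CatA.isSchrodinger V).hwDown i y) _ =
      qInt q (i + 1) • gen q .Y • homLEquiv hq V.obj (CatA.smul_Z V) (i + 1) y _ -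
        (q : ℂ)⁻¹ • gen q .X • gen q .F • homLEquiv hq V.obj (CatA.smul_Z V) (i + 1) y _
    rw [homLEquiv_v, homLEquiv_v]
    rfl
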